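/- Let $\mathbb{R}^3_-=\{x\in\mathbb{R}^3: x_3<0\}$ and $\varrho(x)=(1+|x|^2)^{1/2}$. Let $H^1_0(\mathbb{R}^3_-)$ be the weighted Sobolev space of vector fields $u:\mathbb{R}^3_-\to\mathbb{R}^3$ with $\varrho^{-1}u\in L^2(\mathbb{R}^3_-)$ and distributional gradient $\nabla u\in L^2(\mathbb{R}^3_-)$, normed by $$\|u\|_{H^1_0}^2=\|\varrho^{-1}u\|_{L^2(\mathbb{R}^3_-)}^2+\|\nabla u\|_{L^2(\mathbb{R}^3_-)}^2$$ (no vanishing on $\{x_3=0\}$ is imposed; the subscript $0$ refers to the weight), and let $(H^1_0)'(\mathbb{R}^3_-)$ be its dual space with the dual norm. For a matrix $A$ put $\widehat A=\frac12(A+A^T)$ and $A:B=\sum_{i,j}a_{ij}b_{ij}$. For all constants $M,\alpha_0,\beta_0>0$ there is a constant $C>0$, depending only on $M,\alpha_0,\beta_0$, such that the following holds. Let $\lambda,\mu$ be real functions that are Lipschitz continuous on $\mathbb{R}^3_-$, with $$\|\mu\|_{C^{0,1}}+\|\lambda\|_{C^{0,1}}\le M,\qquad \|g\|_{C^{0,1}}=\|g\|_{L^\infty(\mathbb{R}^3_-)}+\|\nabla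 g\|_{L^\infty(\mathbb{R}^3_-)},$$ and suppose that the strong convexity condition $$\mu(x)\ge\alpha_0,\qquad 3\lambda(x)+2\mu(x)\ge\beta_0\qquad\text{for all }x\in\mathbb{R}^3_-$$ holds. Let $\mathbb{C}(x)\widehat A=\lambda(x)\,\mathrm{tr}(\widehat A)\,I+2\mu(x)\widehat A$ be the isotropic elasticity tensor. Then for every $f\in(H^1_0)'(\mathbb{R}^3_-)$ the traction-free source problem $$\mathrm{div}(\mathbb{C}\widehat\nabla u)=f\ \text{ in }\mathbb{R}^3_-,\qquad (\mathbb{C}\widehat\nabla u)e_3=0\ \text{ on }\{x_3=0\},$$ has exactly one weak solution $u\in H^1_0(\mathbb{R}^3_-)$, that is, exactly one $u\in H^1_0(\mathbb{R}^3_-)$ with $$\int_{\mathbb{R}^3_-}\mathbb{C}\widehat\nabla u:\widehat\nabla v\,dx=-\langle f,v\rangle\qquad\text{for all }v\in H^1_0(\mathbb{R}^3_-),$$ and this solution satisfies $$\|u\|_{H^1_0(\mathbb{R}^3_-)}\le C\,\|f\|_{(H^1_0)'(\mathbb{R}^3_-)}.$$ -/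

import Mathlib

open MeasureTheory
open scoped ENNReal NNReal ContDiff

noncomputable section

namespace Elastic

/-- Points and vectors of `ℝ³`, with the Euclidean norm. -/
abbrev R3 : Type := EuclideanSpace ℝ (Fin 3)

/-- Second-order tensors with the norm `|A| = √(A : A)`; the entry `a i j` is the coordinate
of index `(i, j)`. -/
abbrev Tensor2 : Type := EuclideanSpace ℝ (Fin 3 × Fin 3)

/-- The open lower half space `{x ∈ ℝ³ : x₃ < 0}`. -/
def lowerHalfSpace : Set R3 := {x | x 2 < 0}

/-- The weight `ϱ(x) = (1 + |x|²)^{1/2}`. -/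
def rho (x : R3) : ℝ := Real.sqrt (1 + ‖x‖ ^ 2)

/-- Lebesgue measure on the half space. -/
def halfMeasure : Measure R3 := volume.restrict lowerHalfSpace

/-- The measure `ϱ⁻² dx` on the half space, so that `u ∈ L²(ϱ⁻² dx)` iff `ϱ⁻¹ u ∈ L²(dx)`, with
the same norm. -/
def weightedMeasure : Measure R3 :=
  halfMeasure.withDensity fun x => ENNReal.ofReal ((rho x ^ 2)⁻¹)

/-- Test functions on the half space: smooth real functions on `ℝ³` with compact support
contained in the open half space. -/
structure IsTestFunction (φ : R3 → ℝ) : Prop where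
  smooth : ContDiff ℝ ∞ φ
  compact : HasCompactSupport φ
  support : tsupport φ ⊆ lowerHalfSpace

/-- The partial derivative `∂φ/∂xⱼ`. -/
def partialDeriv (j : Fin 3) (φ : R3 → ℝ) (x : R3) : ℝ :=
  fderiv ℝ φ x (EuclideanSpace.single j 1)

/-- `G` is the gradient of the vector field `u` on the half space in the sense of distributions:
`G i j = ∂ⱼ uᵢ`. -/
def IsWeakGradient (u : R3 → R3) (G : R3 → Tensor2) : Prop :=
  ∀ i j : Fin 3, ∀ φ : R3 → ℝ, IsTestFunction φ →
    ∫ x, u x i * partialDeriv j φ x ∂halfMeasure = -∫ x, G x (i, j) * φ x ∂halfMeasure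

/-- The Hilbert space of pairs `(u, G)` with `ϱ⁻¹ u ∈ L²` and `G ∈ L²`, with
`‖(u, G)‖² = ‖ϱ⁻¹ u‖² + ‖G‖²`. -/
abbrev GraphSpace : Type :=
  WithLp 2 (Lp R3 2 weightedMeasure × Lp Tensor2 2 halfMeasure)

theorem one_le_rho_sq (x : R3) : 1 ≤ rho x ^ 2 := by
  have h : (0 : ℝ) ≤ 1 + ‖x‖ ^ 2 := by positivity
  rw [rho, Real.sq_sqrt h]
  nlinarith [sq_nonneg ‖x‖]

theorem continuous_rho : Continuous rho := by
  unfold rho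
  fun_prop

theorem weightedMeasure_le : weightedMeasure ≤ halfMeasure := by
  have h : weightedMeasure ≤ halfMeasure.withDensity 1 := by
    refine withDensity_mono (Filter.Eventually.of_forall fun x => ?_)
    simpa using inv_le_one_of_one_le₀ (one_le_rho_sq x)
  simpa using h

theorem halfMeasure_ac : halfMeasure ≪ weightedMeasure := by
  refine withDensity_absolutelyContinuous' ?_ (Filter.Eventually.of_forall fun x => ?_)
  · exact (((continuous_rho.pow 2).measurable).inv.ennreal_ofReal).aemeasurable
  · have := one_le_rho_sq x
    simp only [ne_eq, ENNReal.ofReal_eq_zero, not_le]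
    positivity

instance : IsFiniteMeasureOnCompacts halfMeasure := by
  unfold halfMeasure
  infer_instance

instance : IsFiniteMeasureOnCompacts weightedMeasure :=
  ⟨fun _ hK => lt_of_le_of_lt (weightedMeasure_le _) hK.measure_lt_top⟩

/-- A function that is square integrable for `ϱ⁻² dx` is integrable against every continuous
compactly supported function. -/
theorem integrable_weighted_mul (u : Lp R3 2 weightedMeasure) (i : Fin 3) {ψ : R3 → ℝ}
    (hψ : Continuous ψ) (hc : HasCompactSupport ψ) :
    Integrable (fun x => u x i * ψ x) halfMeasure := by
  have h1 : MemLp (fun x => u x i) 2 weightedMeasure :=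
    (EuclideanSpace.proj (𝕜 := ℝ) i).comp_memLp' (Lp.memLp u)
  have h2 : MemLp (fun x => ψ x * rho x ^ 2) 2 weightedMeasure :=
    (hψ.mul (continuous_rho.pow 2)).memLp_of_hasCompactSupport hc.mul_right
  have h3 : Integrable (fun x => u x i * (ψ x * rho x ^ 2)) weightedMeasure :=
    h1.integrable_mul (q := 2) h2
  have hm : Measurable fun x : R3 => ENNReal.ofReal ((rho x ^ 2)⁻¹) :=
    (continuous_rho.pow 2).measurable.inv.ennreal_ofReal
  have h4 := (integrable_withDensity_iff_integrable_smul' (μ := halfMeasure) hm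
    (Filter.Eventually.of_forall fun _ => ENNReal.ofReal_lt_top)).1 h3
  refine h4.congr (Filter.Eventually.of_forall fun x => ?_)
  have hp : 0 < rho x ^ 2 := lt_of_lt_of_le one_pos (one_le_rho_sq x)
  have hq : (0 : ℝ) ≤ (rho x ^ 2)⁻¹ := by positivity
  simp only [ENNReal.toReal_ofReal hq, smul_eq_mul]
  rw [mul_comm (ψ x), mul_left_comm (u x i), inv_mul_cancel_left₀ hp.ne']

theorem integrable_tensor_mul (G : Lp Tensor2 2 halfMeasure) (k : Fin 3 × Fin 3) {ψ : R3 → ℝ}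
    (hψ : Continuous ψ) (hc : HasCompactSupport ψ) :
    Integrable (fun x => G x k * ψ x) halfMeasure := by
  have h1 : MemLp (fun x => G x k) 2 halfMeasure :=
    (EuclideanSpace.proj (𝕜 := ℝ) k).comp_memLp' (Lp.memLp G)
  exact h1.integrable_mul (q := 2) (hψ.memLp_of_hasCompactSupport hc)

theorem IsTestFunction.continuous_partialDeriv {φ : R3 → ℝ} (hφ : IsTestFunction φ)
    (j : Fin 3) : Continuous (partialDeriv j φ) :=
  (hφ.smooth.continuous_fderiv (by simp)).clm_apply continuous_const

theorem IsTestFunction.hasCompactSupport_partialDeriv {φ : R3 → ℝ} (hφ : IsTestFunction φ)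
    (j : Fin 3) : HasCompactSupport (partialDeriv j φ) :=
  hφ.compact.fderiv_apply (𝕜 := ℝ) _

/-- The weighted Sobolev space `H¹₀(ℝ³₋)` of vector fields `u` with `ϱ⁻¹ u ∈ L²(ℝ³₋)` and
distributional gradient `∇u ∈ L²(ℝ³₋)`. A vector field is stored with its gradient, which it
determines (see `H10.ext_of_displacement`); the norm is
`‖u‖² = ‖ϱ⁻¹ u‖²_{L²} + ‖∇u‖²_{L²}`. -/
def H10 : Submodule ℝ GraphSpace where
  carrier := {w | IsWeakGradient w.fst w.snd}
  zero_mem' := by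
    intro i j φ _
    have h1 : ∀ᵐ x ∂halfMeasure, (0 : Lp R3 2 weightedMeasure) x = 0 :=
      halfMeasure_ac.ae_le (Lp.coeFn_zero R3 2 weightedMeasure)
    have h2 : ∀ᵐ x ∂halfMeasure, (0 : Lp Tensor2 2 halfMeasure) x = 0 :=
      Lp.coeFn_zero Tensor2 2 halfMeasure
    rw [integral_eq_zero_of_ae, integral_eq_zero_of_ae, neg_zero]
    · filter_upwards [h2] with x hx
      change (0 : Lp Tensor2 2 halfMeasure) x (i, j) * φ x = 0
      rw [hx, PiLp.zero_apply, zero_mul]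
    · filter_upwards [h1] with x hx
      change (0 : Lp R3 2 weightedMeasure) x i * partialDeriv j φ x = 0
      rw [hx, PiLp.zero_apply, zero_mul]
  add_mem' := by
    intro v w hv hw i j φ hφ
    have h1 : ∀ᵐ x ∂halfMeasure, (v.fst + w.fst) x = v.fst x + w.fst x :=
      halfMeasure_ac.ae_le (Lp.coeFn_add v.fst w.fst)
    have h2 : ∀ᵐ x ∂halfMeasure, (v.snd + w.snd) x = v.snd x + w.snd x :=
      Lp.coeFn_add v.snd w.snd
    have d1 := hφ.continuous_partialDeriv j
    have d2 := hφ.hasCompactSupport_partialDeriv j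
    have d3 := hφ.smooth.continuous
    have e1 : ∫ x, (v.fst + w.fst) x i * partialDeriv j φ x ∂halfMeasure
        = ∫ x, (v.fst x i * partialDeriv j φ x + w.fst x i * partialDeriv j φ x)
          ∂halfMeasure := by
      refine integral_congr_ae ?_
      filter_upwards [h1] with x hx
      rw [hx, PiLp.add_apply, add_mul]
    have e2 : ∫ x, (v.snd + w.snd) x (i, j) * φ x ∂halfMeasure
        = ∫ x, (v.snd x (i, j) * φ x + w.snd x (i, j) * φ x) ∂halfMeasure := by
      refine integral_congr_ae ?_
      filter_upwards [h2] with x hx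
      rw [hx, PiLp.add_apply, add_mul]
    rw [integral_add (integrable_weighted_mul _ i d1 d2) (integrable_weighted_mul _ i d1 d2)]
      at e1
    rw [integral_add (integrable_tensor_mul _ (i, j) d3 hφ.compact)
      (integrable_tensor_mul _ (i, j) d3 hφ.compact)] at e2
    simp only [WithLp.add_fst, WithLp.add_snd]
    rw [e1, e2, hv i j φ hφ, hw i j φ hφ]
    ring
  smul_mem' := by
    intro c v hv i j φ hφ
    have h1 : ∀ᵐ x ∂halfMeasure, (c • v.fst) x = c • v.fst x :=
      halfMeasure_ac.ae_le (Lp.coeFn_smul c v.fst)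
    have h2 : ∀ᵐ x ∂halfMeasure, (c • v.snd) x = c • v.snd x :=
      Lp.coeFn_smul c v.snd
    have e1 : ∫ x, (c • v.fst) x i * partialDeriv j φ x ∂halfMeasure
        = ∫ x, c * (v.fst x i * partialDeriv j φ x) ∂halfMeasure := by
      refine integral_congr_ae ?_
      filter_upwards [h1] with x hx
      rw [hx, PiLp.smul_apply, smul_eq_mul, mul_assoc]
    have e2 : ∫ x, (c • v.snd) x (i, j) * φ x ∂halfMeasure
        = ∫ x, c * (v.snd x (i, j) * φ x) ∂halfMeasure := by
      refine integral_congr_ae ?_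
      filter_upwards [h2] with x hx
      rw [hx, PiLp.smul_apply, smul_eq_mul, mul_assoc]
    rw [integral_const_mul] at e1 e2
    simp only [WithLp.smul_fst, WithLp.smul_snd]
    rw [e1, e2, hv i j φ hφ]
    ring

namespace H10

/-- The vector field `u` underlying an element of `H¹₀(ℝ³₋)`. -/
def displacement (u : H10) : Lp R3 2 weightedMeasure := (u : GraphSpace).fst

/-- The distributional gradient `∇u`, with `(∇u)ᵢⱼ = ∂ⱼuᵢ`. -/
def grad (u : H10) (x : R3) : Matrix (Fin 3) (Fin 3) ℝ :=
  Matrix.of fun i j => (u : GraphSpace).snd x (i, j)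

/-- The deformation tensor `½(∇u + (∇u)ᵀ)`. -/
def strain (u : H10) (x : R3) : Matrix (Fin 3) (Fin 3) ℝ :=
  (1 / 2 : ℝ) • (grad u x + (grad u x).transpose)

/-- An element of `H¹₀(ℝ³₋)` is determined by its underlying vector field. -/
theorem ext_of_displacement {u v : H10} (h : displacement u = displacement v) : u = v := by
  refine Subtype.ext ?_
  have hs : (u : GraphSpace).snd = (v : GraphSpace).snd := by
    refine Lp.ext ?_
    have key : ∀ k : Fin 3 × Fin 3, ∀ᵐ x ∂halfMeasure,
        (u : GraphSpace).snd x k = (v : GraphSpace).snd x k := by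
      rintro ⟨i, j⟩
      have hopen : IsOpen lowerHalfSpace :=
        isOpen_lt (by fun_prop) continuous_const
      have hm : ∀ w : H10, LocallyIntegrable (fun x => (w : GraphSpace).snd x (i, j))
          halfMeasure := fun w =>
        (((EuclideanSpace.proj (𝕜 := ℝ) (i, j)).comp_memLp'
          (Lp.memLp (w : GraphSpace).snd)).locallyIntegrable (by norm_num))
      have := hopen.ae_eq_zero_of_integral_contDiff_smul_eq_zero (μ := halfMeasure)
        (f := fun x => (u : GraphSpace).snd x (i, j) - (v : GraphSpace).snd x (i, j))
        (((hm u).sub (hm v)).locallyIntegrableOn _) (fun g g1 g2 g3 => by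
          have hg : IsTestFunction g := ⟨g1, g2, g3⟩
          have eu := u.2 i j g hg
          have ev := v.2 i j g hg
          have h' : (u : GraphSpace).fst = (v : GraphSpace).fst := h
          rw [h', ev, neg_inj] at eu
          simp only [smul_eq_mul, mul_sub]
          simp only [mul_comm (g _)]
          rw [integral_sub (integrable_tensor_mul _ _ g1.continuous g2)
            (integrable_tensor_mul _ _ g1.continuous g2), eu, sub_self])
      filter_upwards [this, ae_restrict_mem hopen.measurableSet] with x hx hx'
      exact sub_eq_zero.1 (hx hx')
    filter_upwards [ae_all_iff.2 key] with x hx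
    exact PiLp.ext hx
  exact (WithLp.ext_iff 2).2 (Prod.ext h hs)

end H10

/-- The isotropic elasticity tensor `ℂ = λ I ⊗ I + 2μ 𝕀` applied to a symmetric tensor `A`. -/
def elasticityTensor (lam mu : ℝ) (A : Matrix (Fin 3) (Fin 3) ℝ) : Matrix (Fin 3) (Fin 3) ℝ :=
  (lam * A.trace) • (1 : Matrix (Fin 3) (Fin 3) ℝ) + (2 * mu) • A

/-- The inner product `A : B = ∑ᵢⱼ aᵢⱼ bᵢⱼ` of second-order tensors. -/
def doubleDot (A B : Matrix (Fin 3) (Fin 3) ℝ) : ℝ := ∑ i, ∑ j, A i j * B i j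

/-- The bilinear form `a(u, v) = ∫ ℂ ½(∇u + ∇uᵀ) : ½(∇v + ∇vᵀ) dx` of the Lamé operator over the
half space. -/
def lameForm (lam mu : R3 → ℝ) (u v : H10) : ℝ :=
  ∫ x, doubleDot (elasticityTensor (lam x) (mu x) (H10.strain u x)) (H10.strain v x) ∂halfMeasure

/-- `u ∈ H¹₀(ℝ³₋)` is a weak solution of `div (ℂ ½(∇u + ∇uᵀ)) = f` in the half space with zero
traction on the boundary plane: `a(u, v) = -⟨f, v⟩` for every `v ∈ H¹₀(ℝ³₋)`. -/
def IsWeakSolution (lam mu : R3 → ℝ) (f : StrongDual ℝ H10) (u : H10) : Prop :=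
  ∀ v : H10, lameForm lam mu u v = -f v

/-- The norm `‖g‖_{L^∞} + ‖∇g‖_{L^∞}` over the half space, for a Lipschitz function `g`. -/
def c01Norm (g : R3 → ℝ) : ℝ≥0∞ :=
  eLpNorm g ∞ halfMeasure + eLpNorm (fun x => fderiv ℝ g x) ∞ halfMeasure

/-- The Lamé coefficients are Lipschitz on the half space, with `C^{0,1}` norms summing up to at
most `M`. -/
structure LipschitzModuli (M : ℝ) (lam mu : R3 → ℝ) : Prop where
  lipschitz_lam : ∃ K : ℝ≥0, LipschitzOnWith K lam lowerHalfSpace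
  lipschitz_mu : ∃ K : ℝ≥0, LipschitzOnWith K mu lowerHalfSpace
  bound : c01Norm mu + c01Norm lam ≤ ENNReal.ofReal M

/-- Strong convexity: `μ ≥ α₀` and `3λ + 2μ ≥ β₀` in the half space. -/
structure StronglyConvex (α₀ β₀ : ℝ) (lam mu : R3 → ℝ) : Prop where
  shear : ∀ x ∈ lowerHalfSpace, α₀ ≤ mu x
  bulk : ∀ x ∈ lowerHalfSpace, β₀ ≤ 3 * lam x + 2 * mu x

end Elastic

end

noncomputable section

namespace Elastic

/-! ### The divergence theorem on the half space -/

/-! This is Lax–Milgram on the Hilbert space `H10`. The form is bounded because the moduli are.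
Strong convexity bounds `a(u, u)` below by `min (2α₀) β₀` times the squared `L²` norm of the strain.
Everything therefore rests on a weighted Korn inequality `‖u‖² ≤ K ∫ |sym ∇u|²` with an absolute
constant `K` (`weighted_korn`, `korn_H10`), and the solution bound has constant `K / min (2α₀) β₀`.

For smooth fields of compact support, free on the plane, the inequality combines two integrations by
parts. Hardy (`hardy_half`) tests the divergence theorem with `u² x / ϱ²`, whose normal component
vanishes on the plane. Korn (`korn_half`) uses `|∇u|² = 2|sym ∇u|² - (div u)² + 2 Σ (2×2 principal
minors)`. The minors are null Lagrangians, so only boundary terms remain. These cancel when the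
identity is added to the one for a reflected field `w`, built inside the half space by stretching in
`x₃`, with the tangential trace of `u` and the opposite normal trace. The stretching enters as `D (u
∘ D)`, so the strain of `w` is controlled by that of `u`.

General elements are reached in two limits. Convolution with kernels supported in `x₃ > 0` samples a
function only deeper in the half space, so it commutes there with weak derivatives and no extension
operator is needed. Cutoffs at scale `n` have gradients of size `O(1/ϱ)`, exactly what the weight
absorbs. In both limits Fatou handles the left side, so only the strain integrals on the right need
control: `L²` contraction in the first limit, dominated convergence in the second. -/

theorem isOpen_lowerHalfSpace : IsOpen lowerHalfSpace :=
  isOpen_lt (by fun_prop) continuous_const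

theorem measurableSet_lowerHalfSpace : MeasurableSet lowerHalfSpace :=
  isOpen_lowerHalfSpace.measurableSet

/-- Fubini, with the `j`-th coordinate split off as the inner variable. -/
theorem integral_eq_zero_of_integral_line_eq_zero (j : Fin 3) {g : R3 → ℝ} (hg : Integrable g)
    (h : ∀ x : R3, ∫ t : ℝ, g (x + t • EuclideanSpace.single j 1) = 0) : ∫ x, g x = 0 := by
  have e1 := PiLp.volume_preserving_toLp (Fin 3)
  have e2 := (volume_preserving_piFinSuccAbove (fun _ : Fin 3 => ℝ) j).symm
  have e3 := e1.comp e2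
  have emb : MeasurableEmbedding ((WithLp.toLp 2 : (Fin 3 → ℝ) → R3) ∘
      (MeasurableEquiv.piFinSuccAbove (fun _ : Fin 3 => ℝ) j).symm) :=
    (MeasurableEquiv.toLp 2 (Fin 3 → ℝ)).measurableEmbedding.comp
      (MeasurableEquiv.measurableEmbedding _)
  rw [← e3.integral_comp emb]
  have hi := (e3.integrable_comp_emb emb).2 hg
  rw [Measure.volume_eq_prod] at hi ⊢
  refine (integral_prod_symm _ hi).trans ?_
  refine integral_eq_zero_of_ae (Filter.Eventually.of_forall fun z => ?_)
  -- A base point with `j`-th coordinate `0` makes the line parameter equal to that coordinate.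
  have := h (WithLp.toLp 2 (Fin.insertNth (α := fun _ => ℝ) j 0 z))
  simp only [Pi.zero_apply]
  rw [← this]
  congr 1
  funext t
  simp only [Function.comp]
  congr 1
  ext k
  refine Fin.succAboveCases j ?_ (fun k => ?_) k <;>
  simp [MeasurableEquiv.piFinSuccAbove, Fin.insertNthEquiv]

theorem contDiff_partialDeriv {F : R3 → ℝ} {n m : WithTop ℕ∞} (hF : ContDiff ℝ n F)
    (h : m + 1 ≤ n) (j : Fin 3) : ContDiff ℝ m (partialDeriv j F) :=
  (hF.fderiv_right h).clm_apply contDiff_const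

theorem continuous_partialDeriv {F : R3 → ℝ} (hF : ContDiff ℝ 1 F) (j : Fin 3) :
    Continuous (partialDeriv j F) :=
  (hF.continuous_fderiv (by simp)).clm_apply continuous_const

theorem hasCompactSupport_partialDeriv {F : R3 → ℝ} (hc : HasCompactSupport F) (j : Fin 3) :
    HasCompactSupport (partialDeriv j F) :=
  hc.fderiv_apply (𝕜 := ℝ) _

theorem hasDerivAt_line {F : R3 → ℝ} (hF : ContDiff ℝ 1 F) (j : Fin 3) (x : R3) (t : ℝ) :
    HasDerivAt (fun t : ℝ => F (x + t • EuclideanSpace.single j 1))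
      (partialDeriv j F (x + t • EuclideanSpace.single j 1)) t := by
  have h1 : HasDerivAt (fun t : ℝ => x + t • (EuclideanSpace.single j 1 : R3))
      (EuclideanSpace.single j 1) t := by
    simpa using ((hasDerivAt_id t).smul_const (EuclideanSpace.single j 1 : R3)).const_add x
  exact ((hF.differentiable (by simp) _).hasFDerivAt).comp_hasDerivAt t h1

theorem isClosedEmbedding_line (j : Fin 3) (x : R3) :
    Topology.IsClosedEmbedding (fun t : ℝ => x + t • (EuclideanSpace.single j 1 : R3)) := by
  refine (Homeomorph.addLeft x).isClosedEmbedding.comp ?_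
  exact isClosedEmbedding_smul_left (by
    intro h
    have := congrArg (fun v : R3 => v j) h
    simp at this)

/-- A line in a tangential direction lies in the half space or misses it, while a vertical line
meets it in a half-line ending on the plane. The fundamental theorem of calculus on each line leaves
only the value of `F` at that end. -/
theorem integral_half_partialDeriv_eq_zero {F : R3 → ℝ} (hF : ContDiff ℝ 1 F)
    (hc : HasCompactSupport F) (j : Fin 3) (h0 : j = 2 → ∀ x : R3, x 2 = 0 → F x = 0) :
    ∫ x, partialDeriv j F x ∂halfMeasure = 0 := by
  have hcont := continuous_partialDeriv hF j
  have hcs := hasCompactSupport_partialDeriv hc j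
  rw [halfMeasure, ← integral_indicator measurableSet_lowerHalfSpace]
  refine integral_eq_zero_of_integral_line_eq_zero j
    ((hcont.integrable_of_hasCompactSupport hcs).indicator measurableSet_lowerHalfSpace) ?_
  intro x
  have hemb := isClosedEmbedding_line j x
  have hFl : HasCompactSupport fun t : ℝ => F (x + t • EuclideanSpace.single j 1) :=
    hc.comp_isClosedEmbedding hemb
  have hcl : HasCompactSupport fun t : ℝ =>
      partialDeriv j F (x + t • EuclideanSpace.single j 1) :=
    hcs.comp_isClosedEmbedding hemb
  have hint : Integrable fun t : ℝ => partialDeriv j F (x + t • EuclideanSpace.single j 1) :=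
    (hcont.comp hemb.continuous).integrable_of_hasCompactSupport hcl
  by_cases hj : j = 2
  · subst hj
    have : (fun t : ℝ => lowerHalfSpace.indicator (partialDeriv 2 F)
        (x + t • EuclideanSpace.single 2 1)) = (Set.Iio (-x 2)).indicator
          fun t : ℝ => partialDeriv 2 F (x + t • EuclideanSpace.single 2 1) := by
      funext t
      have : x + t • EuclideanSpace.single 2 1 ∈ lowerHalfSpace ↔ t ∈ Set.Iio (-x 2) := by
        simp only [lowerHalfSpace, Set.mem_ofPred_eq, Set.mem_Iio, PiLp.add_apply, PiLp.smul_apply,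
          PiLp.single_apply, if_true, smul_eq_mul, mul_one]
        constructor <;> intro h <;> linarith
      by_cases h : t ∈ Set.Iio (-x 2)
      · rw [Set.indicator_of_mem h, Set.indicator_of_mem (this.2 h)]
      · rw [Set.indicator_of_notMem h, Set.indicator_of_notMem (fun h' => h (this.1 h'))]
    -- The half-line ends at `t = -x₃`, a point of the plane, where `h0` makes `F` vanish.
    rw [this, integral_indicator measurableSet_Iio, ← integral_Iic_eq_integral_Iio,
      integral_Iic_of_hasDerivAt_of_tendsto' (fun t _ => hasDerivAt_line hF 2 x t)
        hint.integrableOn (hFl.is_zero_at_infty.mono_left atBot_le_cocompact),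
      h0 rfl _ (by simp), sub_zero]
  · have hmem : ∀ t : ℝ, x + t • EuclideanSpace.single j 1 ∈ lowerHalfSpace ↔
        x ∈ lowerHalfSpace := by
      intro t
      simp [lowerHalfSpace, Ne.symm hj]
    by_cases hx : x ∈ lowerHalfSpace
    · have : (fun t : ℝ => lowerHalfSpace.indicator (partialDeriv j F)
        (x + t • EuclideanSpace.single j 1)) =
          fun t : ℝ => partialDeriv j F (x + t • EuclideanSpace.single j 1) := by
        funext t
        rw [Set.indicator_of_mem ((hmem t).2 hx)]
      rw [this]
      refine integral_eq_zero_of_hasDerivAt_of_integrable (fun t => hasDerivAt_line hF j x t)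
        hint ?_
      exact ((hF.continuous.comp hemb.continuous).integrable_of_hasCompactSupport hFl)
    · have : (fun t : ℝ => lowerHalfSpace.indicator (partialDeriv j F)
        (x + t • EuclideanSpace.single j 1)) = fun _ => 0 := by
        funext t
        rw [Set.indicator_of_notMem (fun h => hx ((hmem t).1 h))]
      rw [this, integral_zero]

/-! ### Hardy's inequality -/

theorem rho_sq (x : R3) : rho x ^ 2 = 1 + ∑ i, x i ^ 2 := by
  rw [rho, Real.sq_sqrt (by positivity), EuclideanSpace.real_norm_sq_eq]

theorem rho_pos (x : R3) : 0 < rho x := by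
  rw [rho]; positivity

theorem contDiff_rho_sq {n : WithTop ℕ∞} : ContDiff ℝ n fun x : R3 => rho x ^ 2 := by
  simp only [rho_sq]
  fun_prop

theorem partialDeriv_mul {f g : R3 → ℝ} {x : R3} (hf : DifferentiableAt ℝ f x)
    (hg : DifferentiableAt ℝ g x) (j : Fin 3) :
    partialDeriv j (fun y => f y * g y) x =
      partialDeriv j f x * g x + f x * partialDeriv j g x := by
  simp only [partialDeriv]
  rw [fderiv_fun_mul hf hg]
  simp
  ring

theorem partialDeriv_coord (i j : Fin 3) (x : R3) :
    partialDeriv j (fun y : R3 => y i) x = if i = j then 1 else 0 := by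
  have : (fun y : R3 => y i) = EuclideanSpace.proj (𝕜 := ℝ) i := rfl
  rw [partialDeriv, this, ContinuousLinearMap.fderiv]
  simp

theorem partialDeriv_rho_sq (j : Fin 3) (x : R3) :
    partialDeriv j (fun y => rho y ^ 2) x = 2 * x j := by
  have h : (fun y : R3 => rho y ^ 2) = fun y : R3 => 1 + ‖y‖ ^ 2 := by
    funext y
    rw [rho, Real.sq_sqrt (by positivity)]
  rw [partialDeriv, h, fderiv_const_add, (hasStrictFDerivAt_norm_sq x).hasFDerivAt.fderiv]
  simp [EuclideanSpace.inner_single_right]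

theorem partialDeriv_inv {f : R3 → ℝ} {x : R3} (hf : DifferentiableAt ℝ f x) (h0 : f x ≠ 0)
    (j : Fin 3) : partialDeriv j (fun y => (f y)⁻¹) x = -partialDeriv j f x * (f x)⁻¹ ^ 2 := by
  simp only [partialDeriv]
  have := ((hasDerivAt_inv h0).comp_hasFDerivAt x hf.hasFDerivAt).fderiv
  simp only [Function.comp_def] at this
  rw [this]
  simp
  ring

theorem hasCompactSupport_sq {f : R3 → ℝ} (hf : HasCompactSupport f) :
    HasCompactSupport fun x => f x ^ 2 := by
  simp only [pow_two]
  exact hf.mul_right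

/-- The right side is `div (v² x / ϱ²)` when `d = ∇v`. With `q = ϱ⁻²`, one has `div (q x) = q +
2q²`, and the cross term `2vq d·x` is absorbed by the squares `(2dⱼ + vq xⱼ)²`. -/
theorem hardy_pointwise (v : ℝ) (d : Fin 3 → ℝ) (x : R3) :
    (1 / 2) * (v ^ 2 * (rho x ^ 2)⁻¹) - 2 * (d 0 ^ 2 + d 1 ^ 2 + d 2 ^ 2) ≤
      (2 * v * d 0 * x 0 * (rho x ^ 2)⁻¹ +
          v ^ 2 * ((rho x ^ 2)⁻¹ - 2 * x 0 ^ 2 * (rho x ^ 2)⁻¹ ^ 2)) +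
        (2 * v * d 1 * x 1 * (rho x ^ 2)⁻¹ +
          v ^ 2 * ((rho x ^ 2)⁻¹ - 2 * x 1 ^ 2 * (rho x ^ 2)⁻¹ ^ 2)) +
        (2 * v * d 2 * x 2 * (rho x ^ 2)⁻¹ +
          v ^ 2 * ((rho x ^ 2)⁻¹ - 2 * x 2 ^ 2 * (rho x ^ 2)⁻¹ ^ 2)) := by
  have hr := rho_sq x
  rw [Fin.sum_univ_three] at hr
  have hp := pow_pos (rho_pos x) 2
  set q := (rho x ^ 2)⁻¹ with hqd
  have hq1 : q * (1 + (x 0 ^ 2 + x 1 ^ 2 + x 2 ^ 2)) = 1 := by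
    rw [← hr, hqd, inv_mul_cancel₀ hp.ne']
  have hq2 : q ^ 2 * (1 + (x 0 ^ 2 + x 1 ^ 2 + x 2 ^ 2)) = q := by
    rw [pow_two, mul_assoc, hq1, mul_one]
  have hq3 : v ^ 2 * q = v ^ 2 * (q ^ 2 * (1 + (x 0 ^ 2 + x 1 ^ 2 + x 2 ^ 2))) := by
    rw [hq2]
  linarith [sq_nonneg (2 * d 0 + v * q * x 0), sq_nonneg (2 * d 1 + v * q * x 1),
    sq_nonneg (2 * d 2 + v * q * x 2), sq_nonneg (v * q)]

theorem hardy_half {u : R3 → ℝ} (hu : ContDiff ℝ 1 u) (hc : HasCompactSupport u) :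
    ∫ x, u x ^ 2 * (rho x ^ 2)⁻¹ ∂halfMeasure ≤
      4 * ∫ x, ∑ j, partialDeriv j u x ^ 2 ∂halfMeasure := by
  have hq : ContDiff ℝ 1 fun x : R3 => (rho x ^ 2)⁻¹ :=
    contDiff_rho_sq.inv fun x => (pow_pos (rho_pos x) 2).ne'
  have hcoord : ∀ j : Fin 3, ContDiff ℝ 1 fun x : R3 => x j := fun j => by fun_prop
  -- The third component carries the factor `x₃`, so there is no boundary term although `u` is free
  -- on the plane.
  let F : Fin 3 → R3 → ℝ := fun j x => (u x * u x) * (x j * (rho x ^ 2)⁻¹)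
  have hF : ∀ j, ContDiff ℝ 1 (F j) := fun j => (hu.mul hu).mul ((hcoord j).mul hq)
  have hFc : ∀ j, HasCompactSupport (F j) := fun j => (hc.mul_right).mul_right
  have hF0 : ∀ j, ∫ x, partialDeriv j (F j) x ∂halfMeasure = 0 := fun j =>
    integral_half_partialDeriv_eq_zero (hF j) (hFc j) j fun hj x hx => by
      subst hj; simp [F, hx]
  have hFi : ∀ j, Integrable (partialDeriv j (F j)) halfMeasure := fun j =>
    (continuous_partialDeriv (hF j) j).integrable_of_hasCompactSupport
      (hasCompactSupport_partialDeriv (hFc j) j)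
  have hFx : ∀ j x, partialDeriv j (F j) x = 2 * u x * partialDeriv j u x * x j * (rho x ^ 2)⁻¹ +
      u x ^ 2 * ((rho x ^ 2)⁻¹ - 2 * x j ^ 2 * (rho x ^ 2)⁻¹ ^ 2) := by
    intro j x
    have d1 := (hu.differentiable (by simp)) x
    have d2 := (hcoord j).differentiable (by simp) x
    have d3 := hq.differentiable (by simp) x
    have d4 : DifferentiableAt ℝ (fun x : R3 => rho x ^ 2) x :=
      (contDiff_rho_sq (n := 1)).differentiable (by simp) x
    have d5 : DifferentiableAt ℝ (fun x => u x * u x) x := d1.mul d1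
    have d6 : DifferentiableAt ℝ (fun x : R3 => x j * (rho x ^ 2)⁻¹) x := d2.mul d3
    rw [partialDeriv_mul d5 d6, partialDeriv_mul d1 d1, partialDeriv_mul d2 d3,
      partialDeriv_coord, partialDeriv_inv d4 (pow_pos (rho_pos x) 2).ne', partialDeriv_rho_sq,
      if_pos rfl]
    ring
  have hdi : ∀ j, Integrable (fun x => partialDeriv j u x ^ 2) halfMeasure := fun j =>
    ((continuous_partialDeriv hu j).pow 2).integrable_of_hasCompactSupport
      (hasCompactSupport_sq (hasCompactSupport_partialDeriv hc j))
  have hui : Integrable (fun x => u x ^ 2 * (rho x ^ 2)⁻¹) halfMeasure :=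
    ((hu.continuous.pow 2).mul hq.continuous).integrable_of_hasCompactSupport
      (hasCompactSupport_sq hc).mul_right
  have hS : Integrable (fun x => ∑ j, partialDeriv j u x ^ 2) halfMeasure :=
    integrable_finsetSum _ fun j _ => hdi j
  have hsum : ∫ x, ∑ j, partialDeriv j (F j) x ∂halfMeasure = 0 := by
    rw [integral_finsetSum _ fun j _ => hFi j]
    simp [hF0]
  have hle : ∫ x, ((1 / 2) * (u x ^ 2 * (rho x ^ 2)⁻¹) - 2 * ∑ j, partialDeriv j u x ^ 2)
      ∂halfMeasure ≤ ∫ x, ∑ j, partialDeriv j (F j) x ∂halfMeasure := by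
    refine integral_mono ((hui.const_mul _).sub (hS.const_mul _))
      (integrable_finsetSum _ fun j _ => hFi j) fun x => ?_
    simp only [hFx, Fin.sum_univ_three]
    exact hardy_pointwise (u x) (fun j => partialDeriv j u x) x
  rw [hsum, integral_sub (hui.const_mul _) (hS.const_mul _), integral_const_mul,
    integral_const_mul] at hle
  linarith

/-! ### Korn's inequality -/

theorem partialDeriv_comm {b : R3 → ℝ} (hb : ContDiff ℝ 2 b) (i j : Fin 3) (x : R3) :
    partialDeriv i (partialDeriv j b) x = partialDeriv j (partialDeriv i b) x := by
  have hd : DifferentiableAt ℝ (fderiv ℝ b) x :=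
    (hb.fderiv_right (m := 1) (by norm_num)).differentiable (by simp) x
  have key : ∀ k l : Fin 3, partialDeriv k (partialDeriv l b) x =
      fderiv ℝ (fderiv ℝ b) x (EuclideanSpace.single k 1) (EuclideanSpace.single l 1) := by
    intro k l
    have : partialDeriv l b = fun y => fderiv ℝ b y (EuclideanSpace.single l 1) := rfl
    rw [partialDeriv, this, fderiv_clm_apply hd (differentiableAt_const _)]
    simp
  rw [key, key]
  exact hb.contDiffAt.isSymmSndFDerivAt (by simp) _ _

theorem partialDeriv_sub {f g : R3 → ℝ} {x : R3} (hf : DifferentiableAt ℝ f x)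
    (hg : DifferentiableAt ℝ g x) (j : Fin 3) :
    partialDeriv j (fun y => f y - g y) x = partialDeriv j f x - partialDeriv j g x := by
  simp only [partialDeriv]
  rw [fderiv_fun_sub hf hg]
  simp

theorem partialDeriv_add {f g : R3 → ℝ} {x : R3} (hf : DifferentiableAt ℝ f x)
    (hg : DifferentiableAt ℝ g x) (j : Fin 3) :
    partialDeriv j (fun y => f y + g y) x = partialDeriv j f x + partialDeriv j g x := by
  simp only [partialDeriv]
  rw [fderiv_fun_add hf hg]
  simp

theorem partialDeriv_const_mul {f : R3 → ℝ} {x : R3} (hf : DifferentiableAt ℝ f x) (c : ℝ)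
    (j : Fin 3) : partialDeriv j (fun y => c * f y) x = c * partialDeriv j f x := by
  simp only [partialDeriv]
  rw [fderiv_const_mul hf]
  simp

/-- The Jacobian minor of `(a, b)` in the variables `(xᵢ, xⱼ)`. -/
def minor (i j : Fin 3) (a b : R3 → ℝ) (x : R3) : ℝ :=
  partialDeriv i a x * partialDeriv j b x - partialDeriv j a x * partialDeriv i b x

theorem continuous_minor {a b : R3 → ℝ} (ha : ContDiff ℝ 1 a) (hb : ContDiff ℝ 1 b)
    (i j : Fin 3) : Continuous (minor i j a b) :=
  ((continuous_partialDeriv ha i).mul (continuous_partialDeriv hb j)).sub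
    ((continuous_partialDeriv ha j).mul (continuous_partialDeriv hb i))

theorem hasCompactSupport_minor {a b : R3 → ℝ} (ha : HasCompactSupport a) (i j : Fin 3) :
    HasCompactSupport (minor i j a b) :=
  ((hasCompactSupport_partialDeriv ha i).mul_right).sub
    ((hasCompactSupport_partialDeriv ha j).mul_right)

/-- The mixed second derivatives of `b` cancel, which gives the minor its divergence form. -/
theorem minor_eq {a b : R3 → ℝ} (ha : ContDiff ℝ 1 a) (hb : ContDiff ℝ 2 b) (i j : Fin 3)
    (x : R3) : minor i j a b x = partialDeriv i (fun y => a y * partialDeriv j b y) x -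
      partialDeriv j (fun y => a y * partialDeriv i b y) x := by
  have d1 := ha.differentiable (by simp) x
  have d2 : ∀ k, DifferentiableAt ℝ (partialDeriv k b) x := fun k =>
    (contDiff_partialDeriv (m := 1) hb (by norm_num) k).differentiable (by simp) x
  rw [partialDeriv_mul d1 (d2 j), partialDeriv_mul d1 (d2 i), partialDeriv_comm hb i j, minor]
  ring

/-- Minors are null Lagrangians: their integrals over the half space depend only on the
boundary values. -/
theorem integral_minor_add_minor {a b a' b' : R3 → ℝ} (ha : ContDiff ℝ 2 a) (hb : ContDiff ℝ 2 b)
    (ha' : ContDiff ℝ 2 a') (hb' : ContDiff ℝ 2 b') (hac : HasCompactSupport a)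
    (hac' : HasCompactSupport a') {i j : Fin 3} (hi : i ≠ 2)
    (h0 : j = 2 → ∀ x : R3, x 2 = 0 →
      a x * partialDeriv i b x + a' x * partialDeriv i b' x = 0) :
    ∫ x, (minor i j a b x + minor i j a' b' x) ∂halfMeasure = 0 := by
  have hle : (1 : WithTop ℕ∞) ≤ 2 := by norm_num
  have ga := ha.of_le hle
  have ga' := ha'.of_le hle
  have gb : ∀ k, ContDiff ℝ 1 (partialDeriv k b) := fun k =>
    contDiff_partialDeriv hb (by norm_num) k
  have gb' : ∀ k, ContDiff ℝ 1 (partialDeriv k b') := fun k =>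
    contDiff_partialDeriv hb' (by norm_num) k
  have c1 : ∀ k, ContDiff ℝ 1 fun y => a y * partialDeriv k b y := fun k => ga.mul (gb k)
  have c2 : ∀ k, ContDiff ℝ 1 fun y => a' y * partialDeriv k b' y := fun k => ga'.mul (gb' k)
  let P : Fin 3 → R3 → ℝ := fun k y => a y * partialDeriv k b y + a' y * partialDeriv k b' y
  have hP : ∀ k, ContDiff ℝ 1 (P k) := fun k => (c1 k).add (c2 k)
  have hPc : ∀ k, HasCompactSupport (P k) := fun k => hac.mul_right.add hac'.mul_right
  have e : ∀ x, minor i j a b x + minor i j a' b' x =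
      partialDeriv i (P j) x - partialDeriv j (P i) x := by
    intro x
    rw [minor_eq ga hb, minor_eq ga' hb',
      partialDeriv_add ((c1 j).differentiable (by simp) x) ((c2 j).differentiable (by simp) x),
      partialDeriv_add ((c1 i).differentiable (by simp) x) ((c2 i).differentiable (by simp) x)]
    ring
  have hint : ∀ k l, Integrable (partialDeriv k (P l)) halfMeasure := fun k l =>
    (continuous_partialDeriv (hP l) k).integrable_of_hasCompactSupport
      (hasCompactSupport_partialDeriv (hPc l) k)
  simp only [e]
  -- As `i` is tangential, `∂ᵢ Pⱼ` leaves no boundary term; that of `∂ⱼ Pᵢ` for `j = 2` is what `h0`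
  -- removes.
  rw [integral_sub (hint i j) (hint j i),
    integral_half_partialDeriv_eq_zero (hP j) (hPc j) i (fun h => absurd h hi),
    integral_half_partialDeriv_eq_zero (hP i) (hPc i) j h0, sub_zero]

/-- The stretching factors of `stretch`. -/
def stretchFactor (i : Fin 3) : ℝ := if i = 2 then 2 else 1

/-- The linear map `(x₁, x₂, x₃) ↦ (x₁, x₂, 2x₃)`. -/
def stretch : R3 →L[ℝ] R3 :=
  LinearMap.toContinuousLinearMap
    { toFun := fun x => WithLp.toLp 2 fun i => stretchFactor i * x i
      map_add' := fun x y => by ext i; simp [mul_add]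
      map_smul' := fun c x => by ext i; simp [mul_left_comm] }

@[simp] theorem stretch_apply (x : R3) (i : Fin 3) : stretch x i = stretchFactor i * x i := rfl

theorem stretch_single (j : Fin 3) :
    stretch (EuclideanSpace.single j 1) = stretchFactor j • EuclideanSpace.single j (1 : ℝ) := by
  ext i
  by_cases h : i = j
  · subst h; simp
  · simp [h]

theorem stretchFactor_pos (i : Fin 3) : 0 < stretchFactor i := by
  unfold stretchFactor; split <;> norm_num

theorem stretchFactor_le (i : Fin 3) : stretchFactor i ≤ 2 := by
  unfold stretchFactor; split <;> norm_num

theorem stretch_injective : Function.Injective stretch := by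
  intro x y h
  ext i
  have := congrArg (fun v : R3 => v i) h
  simpa [(stretchFactor_pos i).ne'] using this

theorem stretch_eq_self {x : R3} (hx : x 2 = 0) : stretch x = x := by
  ext i
  fin_cases i <;> simp [stretchFactor, hx]

theorem det_stretch_ne_zero : LinearMap.det (stretch : R3 →ₗ[ℝ] R3) ≠ 0 := by
  intro h
  have := LinearMap.bot_lt_ker_of_det_eq_zero h
  rw [LinearMap.ker_eq_bot.2 stretch_injective] at this
  exact lt_irrefl _ this

/-- Stretching multiplies `x₃` by a positive factor and so preserves the half space; only the
Jacobian factor of Lebesgue measure appears. -/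
theorem map_stretch_halfMeasure : Measure.map stretch halfMeasure =
    ENNReal.ofReal |(LinearMap.det (stretch : R3 →ₗ[ℝ] R3))⁻¹| • halfMeasure := by
  have h := Measure.map_linearMap_addHaar_eq_smul_addHaar (volume : Measure R3) det_stretch_ne_zero
  have hpre : stretch ⁻¹' lowerHalfSpace = lowerHalfSpace := by
    ext x
    simp only [lowerHalfSpace, Set.mem_preimage, Set.mem_ofPred_eq, stretch_apply, stretchFactor,
      if_true]
    constructor <;> intro h <;> linarith
  have h2 := Measure.restrict_map (μ := (volume : Measure R3)) stretch.continuous.measurable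
    measurableSet_lowerHalfSpace
  rw [hpre] at h2
  rw [halfMeasure, ← h2, ← Measure.restrict_smul]
  exact congrArg (fun m => Measure.restrict m lowerHalfSpace) h

theorem integral_comp_stretch {g : R3 → ℝ} (hg : Continuous g) :
    ∫ x, g (stretch x) ∂halfMeasure =
      |(LinearMap.det (stretch : R3 →ₗ[ℝ] R3))⁻¹| * ∫ x, g x ∂halfMeasure := by
  rw [← integral_map (φ := stretch) stretch.continuous.measurable.aemeasurable
    hg.aestronglyMeasurable, map_stretch_halfMeasure, integral_smul_measure,
    ENNReal.toReal_ofReal (abs_nonneg _), smul_eq_mul]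

theorem hasCompactSupport_comp_stretch {g : R3 → ℝ} (hg : HasCompactSupport g) :
    HasCompactSupport fun x => g (stretch x) :=
  hg.comp_isClosedEmbedding
    (LinearMap.isClosedEmbedding_of_injective (f := (stretch : R3 →ₗ[ℝ] R3))
      (LinearMap.ker_eq_bot.2 stretch_injective))

theorem partialDeriv_comp_stretch {f : R3 → ℝ} (hf : Differentiable ℝ f) (j : Fin 3) (x : R3) :
    partialDeriv j (fun y => f (stretch y)) x =
      stretchFactor j * partialDeriv j f (stretch x) := by
  have := ((hf (stretch x)).hasFDerivAt.comp x stretch.hasFDerivAt).fderiv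
  rw [partialDeriv]
  change fderiv ℝ (f ∘ stretch) x _ = _
  rw [this, ContinuousLinearMap.comp_apply, stretch_single, map_smul, smul_eq_mul, partialDeriv]

/-- The squared norm of the symmetric part of a matrix. -/
def symSq (p : Fin 3 → Fin 3 → ℝ) : ℝ := ∑ i, ∑ j, ((p i j + p j i) / 2) ^ 2

/-- The squared norm of a matrix. -/
def entrySq (p : Fin 3 → Fin 3 → ℝ) : ℝ := ∑ i, ∑ j, p i j ^ 2

theorem symSq_nonneg (p : Fin 3 → Fin 3 → ℝ) : 0 ≤ symSq p := by
  unfold symSq; positivity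

theorem entrySq_nonneg (p : Fin 3 → Fin 3 → ℝ) : 0 ≤ entrySq p := by
  unfold entrySq; positivity

/-- From `2|sym p|² = |p|² + tr (p²)` and `tr (p²) = (tr p)² - 2 Σ (principal minors)`, dropping
`(tr p)²`. The bracket holds the minors with reversed sign, matching `minor i j (u j) (u i)`. -/
theorem entrySq_le (p : Fin 3 → Fin 3 → ℝ) :
    entrySq p ≤ 2 * symSq p - 2 * ((p 1 0 * p 0 1 - p 1 1 * p 0 0) +
      (p 2 0 * p 0 2 - p 2 2 * p 0 0) + (p 2 1 * p 1 2 - p 2 2 * p 1 1)) := by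
  simp only [entrySq, symSq, Fin.sum_univ_three]
  nlinarith [sq_nonneg (p 0 0 + p 1 1 + p 2 2)]

theorem continuous_symSq {p : R3 → Fin 3 → Fin 3 → ℝ} (hp : ∀ i j, Continuous fun x => p x i j) :
    Continuous fun x => symSq (p x) := by
  unfold symSq
  fun_prop

theorem continuous_entrySq {p : R3 → Fin 3 → Fin 3 → ℝ}
    (hp : ∀ i j, Continuous fun x => p x i j) : Continuous fun x => entrySq (p x) := by
  unfold entrySq
  fun_prop

/-- The Jacobian matrix of a vector field given by its components. -/
def jac (u : Fin 3 → R3 → ℝ) (x : R3) : Fin 3 → Fin 3 → ℝ := fun i j => partialDeriv j (u i) x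

theorem hasCompactSupport_of_jac {u : Fin 3 → R3 → ℝ} (hc : ∀ i, HasCompactSupport (u i))
    {Φ : (Fin 3 → Fin 3 → ℝ) → ℝ} (h0 : Φ 0 = 0) : HasCompactSupport fun x => Φ (jac u x) := by
  have hK : IsCompact (⋃ i, tsupport (u i)) := isCompact_iUnion hc
  refine HasCompactSupport.intro hK fun x hx => ?_
  have : jac u x = 0 := by
    funext i j
    have hi : x ∉ tsupport (u i) := fun h => hx (Set.mem_iUnion.2 ⟨i, h⟩)
    have : fderiv ℝ (u i) x = 0 := by
      by_contra h
      exact hi (support_fderiv_subset ℝ h)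
    simp [jac, partialDeriv, this]
  rw [this, h0]

/-- The reflected field `3u - 2 D (u ∘ D)`, where `D` is `stretch`: on the boundary plane its
tangential components are those of `u`, and its normal component is that of `-u`. -/
def kornReflection (u : Fin 3 → R3 → ℝ) (i : Fin 3) (x : R3) : ℝ :=
  3 * u i x - 2 * stretchFactor i * u i (stretch x)

/-- The symmetric part of `D q D` is `D (sym q) D`. This is why the reflection carries a factor `D`
in front of `u ∘ D`: the bound involves no skew part. -/
theorem symSq_reflection_le (p q : Fin 3 → Fin 3 → ℝ) :
    symSq (fun i j => 3 * p i j - 2 * stretchFactor i * (stretchFactor j * q i j)) ≤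
      18 * symSq p + 128 * symSq q := by
  simp only [symSq, Finset.mul_sum]
  rw [← Finset.sum_add_distrib]
  refine Finset.sum_le_sum fun i _ => ?_
  rw [← Finset.sum_add_distrib]
  refine Finset.sum_le_sum fun j _ => ?_
  have h1 := stretchFactor_pos i
  have h2 := stretchFactor_pos j
  have h3 : stretchFactor i * stretchFactor j ≤ 4 := by
    nlinarith [stretchFactor_le i, stretchFactor_le j]
  have h4 : (stretchFactor i * stretchFactor j) ^ 2 ≤ 16 := by
    nlinarith [mul_pos h1 h2]
  set e := (p i j + p j i) / 2
  set f := (q i j + q j i) / 2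
  have : (3 * p i j - 2 * stretchFactor i * (stretchFactor j * q i j) +
      (3 * p j i - 2 * stretchFactor j * (stretchFactor i * q j i))) / 2 =
      3 * e - 2 * (stretchFactor i * stretchFactor j) * f := by
    simp only [e, f]; ring
  rw [this]
  -- `(a - b)² ≤ 2a² + 2b²` gives `18 = 2 · 9` and `128 = 2 · 4 · 16`.
  nlinarith [sq_nonneg (3 * e + 2 * (stretchFactor i * stretchFactor j) * f),
    mul_le_mul_of_nonneg_right h4 (sq_nonneg f)]

/-- Integrate `entrySq_le` for `u` and for its reflection `w` and add: the minors cancel in total,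
and the strain of `w` is bounded through that of `u`. -/
theorem korn_half : ∃ K : ℝ, 0 < K ∧ ∀ u : Fin 3 → R3 → ℝ, (∀ i, ContDiff ℝ 2 (u i)) →
    (∀ i, HasCompactSupport (u i)) →
    ∫ x, entrySq (jac u x) ∂halfMeasure ≤ K * ∫ x, symSq (jac u x) ∂halfMeasure := by
  set κ := |(LinearMap.det (stretch : R3 →ₗ[ℝ] R3))⁻¹| with hκ
  -- `2` comes from `u`, and `36` and `256` are twice the constants of `symSq_reflection_le`; `κ` is
  -- the Jacobian factor of the change of variables by `stretch`.
  refine ⟨2 + 36 + 256 * κ, by positivity, fun u hu hc => ?_⟩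
  set w := kornReflection u
  have hle : (1 : WithTop ℕ∞) ≤ 2 := by norm_num
  have hd : ∀ i, Differentiable ℝ (u i) := fun i => (hu i).differentiable (by norm_num)
  have hds : ∀ i, Differentiable ℝ fun x => u i (stretch x) := fun i =>
    (hd i).comp stretch.differentiable
  have hw2 : ∀ i, ContDiff ℝ 2 (w i) := fun i =>
    (contDiff_const.mul (hu i)).sub (contDiff_const.mul ((hu i).comp stretch.contDiff))
  have hwc : ∀ i, HasCompactSupport (w i) := fun i =>
    (hc i).mul_left.sub (hasCompactSupport_comp_stretch (hc i)).mul_left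
  have hjw : ∀ x, jac w x = fun i j => 3 * jac u x i j -
      2 * stretchFactor i * (stretchFactor j * jac u (stretch x) i j) := by
    intro x
    funext i j
    simp only [jac]
    have : w i = fun x => 3 * u i x - 2 * stretchFactor i * u i (stretch x) := rfl
    rw [this, partialDeriv_sub ((hd i x).const_mul _) ((hds i x).const_mul _),
      partialDeriv_const_mul (hd i x), partialDeriv_const_mul (hds i x),
      partialDeriv_comp_stretch (hd i)]
  -- On the plane `3 - 2 · 2 = -1` for the normal component and `3 - 2 · 1 = 1` for the tangential
  -- ones, so the two products are opposite.
  have hplane : ∀ i : Fin 3, i ≠ 2 → ∀ x : R3, x 2 = 0 →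
      u 2 x * partialDeriv i (u i) x + w 2 x * partialDeriv i (w i) x = 0 := by
    intro i hi x hx
    have h1 : partialDeriv i (w i) x = jac w x i i := rfl
    have h2 : w 2 x = 3 * u 2 x - 2 * stretchFactor 2 * u 2 (stretch x) := rfl
    rw [h1, h2, hjw, stretch_eq_self hx]
    simp only [stretchFactor, jac, if_neg hi, if_true]
    ring
  have m01 := integral_minor_add_minor (hu 1) (hu 0) (hw2 1) (hw2 0) (hc 1) (hwc 1)
    (i := 0) (j := 1) (by decide) (fun h => absurd h (by decide))
  have m02 := integral_minor_add_minor (hu 2) (hu 0) (hw2 2) (hw2 0) (hc 2) (hwc 2)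
    (i := 0) (j := 2) (by decide) (fun _ => hplane 0 (by decide))
  have m12 := integral_minor_add_minor (hu 2) (hu 1) (hw2 2) (hw2 1) (hc 2) (hwc 2)
    (i := 1) (j := 2) (by decide) (fun _ => hplane 1 (by decide))
  have hcu : ∀ i j, Continuous fun x => jac u x i j := fun i j =>
    continuous_partialDeriv ((hu i).of_le hle) j
  have hcw : ∀ i j, Continuous fun x => jac w x i j := fun i j =>
    continuous_partialDeriv ((hw2 i).of_le hle) j
  have zS : symSq 0 = 0 := by simp [symSq]
  have zE : entrySq 0 = 0 := by simp [entrySq]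
  have iE : Integrable (fun x => entrySq (jac u x)) halfMeasure :=
    (continuous_entrySq hcu).integrable_of_hasCompactSupport (hasCompactSupport_of_jac hc zE)
  have sSc := hasCompactSupport_of_jac hc zS
  have iS : Integrable (fun x => symSq (jac u x)) halfMeasure :=
    (continuous_symSq hcu).integrable_of_hasCompactSupport sSc
  have iSD : Integrable (fun x => symSq (jac u (stretch x))) halfMeasure := by
    have h1 : Continuous fun x => symSq (jac u (stretch x)) :=
      (continuous_symSq hcu).comp stretch.continuous
    have h2 : HasCompactSupport fun x => symSq (jac u (stretch x)) :=
      hasCompactSupport_comp_stretch (g := fun x => symSq (jac u x)) sSc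
    exact h1.integrable_of_hasCompactSupport h2
  have iM : ∀ i j k l, Integrable (fun x => minor i j (u k) (u l) x + minor i j (w k) (w l) x)
      halfMeasure := fun i j k l =>
    ((continuous_minor ((hu k).of_le hle) ((hu l).of_le hle) i j).integrable_of_hasCompactSupport
      (hasCompactSupport_minor (hc k) i j)).add
    ((continuous_minor ((hw2 k).of_le hle) ((hw2 l).of_le hle) i j).integrable_of_hasCompactSupport
      (hasCompactSupport_minor (hwc k) i j))
  -- The nonnegative `entrySq (jac w x)` is discarded.
  have hpt : ∀ x, entrySq (jac u x) + 2 * (minor 0 1 (u 1) (u 0) x + minor 0 1 (w 1) (w 0) x) +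
      2 * (minor 0 2 (u 2) (u 0) x + minor 0 2 (w 2) (w 0) x) +
      2 * (minor 1 2 (u 2) (u 1) x + minor 1 2 (w 2) (w 1) x) ≤
      38 * symSq (jac u x) + 256 * symSq (jac u (stretch x)) := by
    intro x
    have h1 := entrySq_le (jac u x)
    have h2 := entrySq_le (jac w x)
    have h3 := entrySq_nonneg (jac w x)
    have h4 := symSq_reflection_le (jac u x) (jac u (stretch x))
    rw [← hjw] at h4
    have hm : ∀ (v : Fin 3 → R3 → ℝ) (i j : Fin 3), minor i j (v j) (v i) x =
        jac v x j i * jac v x i j - jac v x j j * jac v x i i := fun _ _ _ => rfl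
    simp only [hm]
    linarith
  have s1 := iE.add ((iM 0 1 1 0).const_mul 2)
  have s2 := s1.add ((iM 0 2 2 0).const_mul 2)
  have s3 := s2.add ((iM 1 2 2 1).const_mul 2)
  have hmono := integral_mono s3 ((iS.const_mul 38).add (iSD.const_mul 256)) hpt
  have e4 := integral_add' (iS.const_mul 38) (iSD.const_mul 256)
  have e3 := integral_add' s2 ((iM 1 2 2 1).const_mul 2)
  have e2 := integral_add' s1 ((iM 0 2 2 0).const_mul 2)
  have e1 := integral_add' iE ((iM 0 1 1 0).const_mul 2)
  rw [e4, e3, e2, e1] at hmono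
  simp only [integral_const_mul] at hmono
  rw [m01, m02, m12, integral_comp_stretch (continuous_symSq hcu), ← hκ] at hmono
  linarith

/-! ### One-sided mollification -/

/-- `g = ∂ⱼ f` on the half space in the sense of distributions. -/
def HasWeakPartial (j : Fin 3) (f g : R3 → ℝ) : Prop :=
  ∀ φ : R3 → ℝ, IsTestFunction φ →
    ∫ x, f x * partialDeriv j φ x ∂halfMeasure = -∫ x, g x * φ x ∂halfMeasure

/-- A smooth probability density supported in the open upper half space. -/
structure IsOneSidedKernel (k : R3 → ℝ) : Prop where
  smooth : ContDiff ℝ ∞ k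
  compact : HasCompactSupport k
  nonneg : ∀ x, 0 ≤ k x
  integral_eq_one : ∫ x, k x = 1
  support : ∀ x ∈ tsupport k, 0 < x 2

/-- The convolution with `k` of the extension of `f` by zero from the half space. -/
def mollify (k f : R3 → ℝ) : R3 → ℝ :=
  convolution (lowerHalfSpace.indicator f) k (ContinuousLinearMap.mul ℝ ℝ) volume

theorem mollify_apply (k f : R3 → ℝ) (x : R3) :
    mollify k f x = ∫ t, f t * k (x - t) ∂halfMeasure := by
  rw [halfMeasure, ← integral_indicator measurableSet_lowerHalfSpace, mollify, convolution_def]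
  congr 1
  funext t
  by_cases h : t ∈ lowerHalfSpace
  · simp [Set.indicator_of_mem h]
  · simp [Set.indicator_of_notMem h]

theorem memLp_indicator {f : R3 → ℝ} {p : ℝ≥0∞} (hf : MemLp f p halfMeasure) :
    MemLp (lowerHalfSpace.indicator f) p :=
  (memLp_indicator_iff_restrict measurableSet_lowerHalfSpace).2 hf

theorem locallyIntegrable_indicator {f : R3 → ℝ} (hf : MemLp f 2 halfMeasure) :
    LocallyIntegrable (lowerHalfSpace.indicator f) :=
  (memLp_indicator hf).locallyIntegrable (by norm_num)

theorem IsOneSidedKernel.integrable_mul {k f : R3 → ℝ} (hk : IsOneSidedKernel k)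
    (hf : MemLp f 2 halfMeasure) (x : R3) :
    Integrable (fun t => f t * k (x - t)) halfMeasure := by
  have h1 : Continuous fun t => k (x - t) := hk.smooth.continuous.comp (by fun_prop)
  have h2 : HasCompactSupport fun t => k (x - t) :=
    hk.compact.comp_homeomorph (Homeomorph.subLeft x)
  exact hf.integrable_mul (q := 2) (h1.memLp_of_hasCompactSupport h2)

theorem mollify_half_add {k f g : R3 → ℝ} (hk : IsOneSidedKernel k)
    (hf : MemLp f 2 halfMeasure) (hg : MemLp g 2 halfMeasure) (x : R3) :
    mollify k (fun y => (f y + g y) / 2) x = (mollify k f x + mollify k g x) / 2 := by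
  simp only [mollify_apply]
  rw [← integral_add (hk.integrable_mul hf x) (hk.integrable_mul hg x), ← integral_div]
  congr 1
  funext t
  ring

theorem contDiff_mollify {k f : R3 → ℝ} (hk : IsOneSidedKernel k) (hf : MemLp f 2 halfMeasure) :
    ContDiff ℝ ∞ (mollify k f) :=
  hk.compact.contDiff_convolution_right _ (locallyIntegrable_indicator hf) hk.smooth

theorem hasCompactSupport_mollify {k f : R3 → ℝ} (hk : IsOneSidedKernel k)
    (hf : HasCompactSupport f) : HasCompactSupport (mollify k f) := by
  have h : HasCompactSupport (lowerHalfSpace.indicator f) :=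
    hf.mono (Set.support_indicator.subset.trans Set.inter_subset_right)
  exact HasCompactSupport.convolution _ h hk.compact

/-- For `x₃ < 0`, every `t` with `x - t ∈ tsupport k` has `t₃ < x₃ < 0`. Hence `t ↦ k (x - t)` is a
test function, and the weak derivative can be tested against it. -/
theorem partialDeriv_mollify {k f g : R3 → ℝ} {j : Fin 3} (hk : IsOneSidedKernel k)
    (hf : MemLp f 2 halfMeasure) (hw : HasWeakPartial j f g) {x : R3}
    (hx : x ∈ lowerHalfSpace) : partialDeriv j (mollify k f) x = mollify k g x := by
  have hl := locallyIntegrable_indicator hf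
  have hk1 : ContDiff ℝ 1 k := hk.smooth.of_le (by exact_mod_cast le_top)
  have h1 := (hk.compact.hasFDerivAt_convolution_right (ContinuousLinearMap.mul ℝ ℝ) hl hk1
    x).fderiv
  have h2 : partialDeriv j (mollify k f) x = mollify (partialDeriv j k) f x := by
    rw [partialDeriv, mollify, h1, convolution_precompR_apply _ hl (hk.compact.fderiv ℝ)
      (hk1.continuous_fderiv one_ne_zero)]
    rfl
  have hφd : ∀ t, partialDeriv j (fun t => k (x - t)) t = -partialDeriv j k (x - t) := by
    intro t
    have h3 : HasFDerivAt (fun t : R3 => x - t) (-ContinuousLinearMap.id ℝ R3) t :=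
      (hasFDerivAt_id t).const_sub x
    have h4 := ((hk1.differentiable one_ne_zero (x - t)).hasFDerivAt.comp t h3).fderiv
    change fderiv ℝ (k ∘ fun t => x - t) t _ = _
    rw [h4]
    simp [partialDeriv]
  have hφ : IsTestFunction fun t => k (x - t) := by
    refine ⟨hk.smooth.comp (contDiff_const.sub contDiff_id),
      hk.compact.comp_homeomorph (Homeomorph.subLeft x), fun t ht => ?_⟩
    have ht' : x - t ∈ tsupport k :=
      tsupport_comp_subset_preimage k (f := fun t => x - t) (by fun_prop) ht
    have h3 := hk.support _ ht'
    have h4 : x 2 < 0 := hx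
    change t 2 < 0
    simp only [PiLp.sub_apply] at h3
    linarith
  have h5 := hw _ hφ
  simp only [hφd, mul_neg, integral_neg, neg_inj] at h5
  rw [h2, mollify_apply, mollify_apply, h5]

/-- Jensen's inequality, from the nonnegativity of the variance of the extended `f` under the
probability density `k (x - ·)`. -/
theorem sq_mollify_le {k f : R3 → ℝ} (hk : IsOneSidedKernel k) (hf : MemLp f 2 halfMeasure)
    (x : R3) : mollify k f x ^ 2 ≤ convolution (fun t => lowerHalfSpace.indicator f t ^ 2) k
      (ContinuousLinearMap.mul ℝ ℝ) volume x := by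
  set F := lowerHalfSpace.indicator f
  have hF2 : MemLp F 2 := memLp_indicator hf
  have k1 : Continuous fun t => k (x - t) := hk.smooth.continuous.comp (by fun_prop)
  have k2 : HasCompactSupport fun t => k (x - t) :=
    hk.compact.comp_homeomorph (Homeomorph.subLeft x)
  have i1 : Integrable fun t => F t * k (x - t) :=
    hF2.integrable_mul (q := 2) (k1.memLp_of_hasCompactSupport k2)
  have i2 : Integrable fun t => k (x - t) := k1.integrable_of_hasCompactSupport k2
  have i3 : Integrable fun t => F t ^ 2 * k (x - t) :=
    hk.compact.convolutionExists_right (ContinuousLinearMap.mul ℝ ℝ)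
      hF2.integrable_sq.locallyIntegrable hk.smooth.continuous x
  have e2 : ∫ t, k (x - t) = 1 := by
    rw [integral_sub_left_eq_self k volume x, hk.integral_eq_one]
  have hm : mollify k f x = ∫ t, F t * k (x - t) := rfl
  set m := mollify k f x
  have h0 : 0 ≤ ∫ t, (F t - m) ^ 2 * k (x - t) :=
    integral_nonneg fun t => mul_nonneg (sq_nonneg _) (hk.nonneg _)
  have e3 : ∫ t, (F t - m) ^ 2 * k (x - t) =
      ∫ t, (F t ^ 2 * k (x - t) - 2 * m * (F t * k (x - t)) + m ^ 2 * k (x - t)) := by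
    congr 1
    funext t
    ring
  have i4 := i3.sub (i1.const_mul (2 * m))
  have e4 := integral_add' i4 (i2.const_mul (m ^ 2))
  have e5 := integral_sub' i3 (i1.const_mul (2 * m))
  have e6 : ∫ t, (F t - m) ^ 2 * k (x - t) =
      (∫ t, F t ^ 2 * k (x - t)) - 2 * m * m + m ^ 2 * 1 := by
    rw [e3]
    refine e4.trans ?_
    rw [e5, integral_const_mul, integral_const_mul, e2, ← hm]
  change m ^ 2 ≤ ∫ t, F t ^ 2 * k (x - t)
  nlinarith

theorem integral_indicator_sq (f : R3 → ℝ) :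
    ∫ t, lowerHalfSpace.indicator f t ^ 2 = ∫ t, f t ^ 2 ∂halfMeasure := by
  rw [halfMeasure, ← integral_indicator measurableSet_lowerHalfSpace]
  congr 1
  funext t
  by_cases h : t ∈ lowerHalfSpace
  · simp [Set.indicator_of_mem h]
  · simp [Set.indicator_of_notMem h]

theorem integrable_sq_convolution {k f : R3 → ℝ} (hk : IsOneSidedKernel k)
    (hf : MemLp f 2 halfMeasure) :
    Integrable (convolution (fun t => lowerHalfSpace.indicator f t ^ 2) k
      (ContinuousLinearMap.mul ℝ ℝ) volume) :=
  (memLp_indicator hf).integrable_sq.integrable_convolution _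
    (hk.smooth.continuous.integrable_of_hasCompactSupport hk.compact)

theorem integrable_mollify_sq {k f : R3 → ℝ} (hk : IsOneSidedKernel k)
    (hf : MemLp f 2 halfMeasure) : Integrable (fun x => mollify k f x ^ 2) :=
  (integrable_sq_convolution hk hf).mono'
    ((contDiff_mollify hk hf).continuous.pow 2).aestronglyMeasurable
    (Filter.Eventually.of_forall fun x => by
      rw [Real.norm_of_nonneg (sq_nonneg _)]
      exact sq_mollify_le hk hf x)

theorem integral_mollify_sq_le {k f : R3 → ℝ} (hk : IsOneSidedKernel k)
    (hf : MemLp f 2 halfMeasure) :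
    ∫ x, mollify k f x ^ 2 ∂halfMeasure ≤ ∫ x, f x ^ 2 ∂halfMeasure := by
  have hi := integrable_mollify_sq hk hf
  calc ∫ x, mollify k f x ^ 2 ∂halfMeasure ≤ ∫ x, mollify k f x ^ 2 :=
        setIntegral_le_integral hi (Filter.Eventually.of_forall fun x => sq_nonneg _)
    _ ≤ ∫ x, convolution (fun t => lowerHalfSpace.indicator f t ^ 2) k
          (ContinuousLinearMap.mul ℝ ℝ) volume x :=
        integral_mono hi (integrable_sq_convolution hk hf) (sq_mollify_le hk hf)
    _ = ∫ x, f x ^ 2 ∂halfMeasure := by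
        rw [integral_convolution _ (memLp_indicator hf).integrable_sq
          (hk.smooth.continuous.integrable_of_hasCompactSupport hk.compact),
          hk.integral_eq_one, integral_indicator_sq]
        simp

/-- A bump function of outer radius `1 / (n + 1)`. -/
def bump (n : ℕ) : ContDiffBump (0 : R3) where
  rIn := 1 / (2 * (n + 1))
  rOut := 1 / (n + 1)
  rIn_pos := by positivity
  rIn_lt_rOut := by
    apply one_div_lt_one_div_of_lt <;> [positivity; (have : (0 : ℝ) ≤ n := n.cast_nonneg; linarith)]

/-- The centre of the `n`-th one-sided kernel. -/
def kernelCentre (n : ℕ) : R3 := EuclideanSpace.single 2 (2 / ((n : ℝ) + 1))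

/-- A sequence of one-sided kernels concentrating at the origin. -/
def kernel (n : ℕ) (x : R3) : ℝ := (bump n).normed volume (x - kernelCentre n)

theorem support_kernel (n : ℕ) :
    Function.support (kernel n) = Metric.ball (kernelCentre n) (1 / ((n : ℝ) + 1)) := by
  have h := (bump n).support_normed_eq (μ := volume)
  ext x
  have h2 := Set.ext_iff.1 h (x - kernelCentre n)
  simpa [kernel, bump, dist_eq_norm] using h2

theorem norm_kernelCentre (n : ℕ) : ‖kernelCentre n‖ = 2 / ((n : ℝ) + 1) := by
  rw [kernelCentre, PiLp.norm_single, Real.norm_of_nonneg (by positivity)]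

theorem isOneSidedKernel_kernel (n : ℕ) : IsOneSidedKernel (kernel n) where
  smooth := (bump n).contDiff_normed.comp (contDiff_id.sub contDiff_const)
  compact := (bump n).hasCompactSupport_normed.comp_homeomorph (Homeomorph.subRight _)
  nonneg x := (bump n).nonneg_normed _
  integral_eq_one := by
    simp only [kernel]
    rw [integral_sub_right_eq_self (fun x => (bump n).normed volume x), (bump n).integral_normed]
  support x hx := by
    have h1 : x ∈ Metric.closedBall (kernelCentre n) (1 / ((n : ℝ) + 1)) := by
      rw [tsupport, support_kernel] at hx
      exact Metric.closure_ball_subset_closedBall hx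
    rw [Metric.mem_closedBall, dist_eq_norm] at h1
    have h2 := (PiLp.norm_apply_le (x - kernelCentre n) 2).trans h1
    rw [Real.norm_eq_abs, abs_le] at h2
    have h3 : kernelCentre n 2 = 2 / ((n : ℝ) + 1) := by simp [kernelCentre]
    have h4 : (2 : ℝ) / ((n : ℝ) + 1) = 2 * (1 / ((n : ℝ) + 1)) := by ring
    have h5 : (0 : ℝ) < 1 / ((n : ℝ) + 1) := by positivity
    have h6 := h2.1
    rw [PiLp.sub_apply, h3, h4] at h6
    linarith

/-- `216 = 2³ · 3³`: the ratio of outer to inner bump radius is `2`, and the comparison ball has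
three times the outer radius. -/
theorem kernel_le (n : ℕ) (x y : R3) :
    kernel n y ≤ 216 / volume.real (Metric.closedBall x (3 * (1 / ((n : ℝ) + 1)))) := by
  have h1 := (bump n).normed_le_div_measure_closedBall_rOut volume 2 (by
    simp only [bump]; apply le_of_eq; field_simp) (y - kernelCentre n)
  have h2 : (0 : ℝ) ≤ 1 / ((n : ℝ) + 1) := by positivity
  have h3 : (bump n).rOut = 1 / ((n : ℝ) + 1) := rfl
  refine h1.trans (le_of_eq ?_)
  rw [h3, Measure.addHaar_real_closedBall' _ _ h2,
    Measure.addHaar_real_closedBall' _ x (by positivity : (0 : ℝ) ≤ 3 * (1 / ((n : ℝ) + 1)))]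
  rw [show Module.finrank ℝ R3 = 3 by simp]
  have h4 : 0 < volume.real (Metric.closedBall (0 : R3) 1) :=
    ENNReal.toReal_pos (Metric.measure_closedBall_pos _ _ one_pos).ne' measure_closedBall_lt_top.ne
  have h5 : (0 : ℝ) < (n : ℝ) + 1 := by positivity
  field_simp
  norm_num

/-- Lebesgue differentiation suffices although the kernels are off-centre: `y ↦ kernel n (x - y)`
lives in the ball of radius `3/(n+1)` about `x` and is bounded by a constant over its volume. -/
theorem ae_tendsto_mollify {f : R3 → ℝ} (hf : MemLp f 2 halfMeasure) :
    ∀ᵐ x ∂halfMeasure, Filter.Tendsto (fun n => mollify (kernel n) f x) Filter.atTop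
      (nhds (f x)) := by
  have hl := locallyIntegrable_indicator hf
  have key : ∀ᵐ x : R3, Filter.Tendsto (fun n => mollify (kernel n) f x) Filter.atTop
      (nhds (lowerHalfSpace.indicator f x)) := by
    filter_upwards [(Besicovitch.vitaliFamily (volume : Measure R3)).ae_tendsto_average_norm_sub hl]
      with x hx
    have hr : Filter.Tendsto (fun n : ℕ => 3 * (1 / ((n : ℝ) + 1))) Filter.atTop
        (nhdsWithin 0 (Set.Ioi 0)) := by
      refine tendsto_nhdsWithin_iff.2 ⟨?_, Filter.Eventually.of_forall fun n => ?_⟩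
      · simpa using (tendsto_one_div_add_atTop_nhds_zero_nat (𝕜 := ℝ)).const_mul 3
      · simp only [Set.mem_Ioi]; positivity
    have h1 := (hx.comp (Besicovitch.tendsto_filterAt volume x)).comp hr
    have h2 := tendsto_integral_smul_of_tendsto_average_norm_sub (g := fun n y => kernel n (x - y))
      216 h1 (Filter.Eventually.of_forall fun n => hl.integrableOn_isCompact
        (isCompact_closedBall _ _)) ?_ ?_ ?_
    · refine h2.congr fun n => ?_
      rw [mollify, convolution_def]
      congr 1
      funext t
      simp [mul_comm]
    · refine tendsto_const_nhds.congr fun n => ?_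
      rw [integral_sub_left_eq_self (kernel n) volume x,
        (isOneSidedKernel_kernel n).integral_eq_one]
    · refine Filter.Eventually.of_forall fun n y hy => ?_
      have hy' : x - y ∈ Function.support (kernel n) := hy
      rw [support_kernel, Metric.mem_ball, dist_eq_norm] at hy'
      have h3 : ‖x - y‖ ≤ ‖x - y - kernelCentre n‖ + ‖kernelCentre n‖ := by
        simpa using norm_add_le (x - y - kernelCentre n) (kernelCentre n)
      rw [norm_kernelCentre] at h3
      have h4 : (2 : ℝ) / ((n : ℝ) + 1) = 2 * (1 / ((n : ℝ) + 1)) := by ring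
      rw [Metric.mem_closedBall, dist_comm, dist_eq_norm]
      linarith
    · refine Filter.Eventually.of_forall fun n y => ?_
      rw [abs_of_nonneg ((isOneSidedKernel_kernel n).nonneg _)]
      exact kernel_le n x _
  filter_upwards [ae_restrict_of_ae key, ae_restrict_mem measurableSet_lowerHalfSpace]
    with x hx hm
  rwa [Set.indicator_of_mem hm] at hx

/-- Fatou's lemma for real integrals. -/
theorem integral_le_of_ae_tendsto {α : Type*} [MeasurableSpace α] {μ : Measure α}
    {F : ℕ → α → ℝ} {f : α → ℝ} (hF : ∀ n, Integrable (F n) μ) (hF0 : ∀ n x, 0 ≤ F n x)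
    (hlim : ∀ᵐ x ∂μ, Filter.Tendsto (fun n => F n x) Filter.atTop (nhds (f x)))
    {c : ℕ → ℝ} {C : ℝ} (hc : ∀ n, ∫ x, F n x ∂μ ≤ c n)
    (hC : Filter.Tendsto c Filter.atTop (nhds C)) : ∫ x, f x ∂μ ≤ C := by
  have hf0 : 0 ≤ᵐ[μ] f := by
    filter_upwards [hlim] with x hx
    exact ge_of_tendsto' hx fun n => hF0 n x
  have hfm : AEStronglyMeasurable f μ :=
    aestronglyMeasurable_of_tendsto_ae _ (fun n => (hF n).aestronglyMeasurable) hlim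
  have hC0 : 0 ≤ C := ge_of_tendsto' hC fun n => (integral_nonneg (hF0 n)).trans (hc n)
  rw [integral_eq_lintegral_of_nonneg_ae hf0 hfm]
  refine ENNReal.toReal_le_of_le_ofReal hC0 ?_
  calc ∫⁻ x, ENNReal.ofReal (f x) ∂μ
      = ∫⁻ x, Filter.liminf (fun n => ENNReal.ofReal (F n x)) Filter.atTop ∂μ := by
        refine lintegral_congr_ae ?_
        filter_upwards [hlim] with x hx
        exact ((ENNReal.continuous_ofReal.tendsto _).comp hx).liminf_eq.symm
    _ ≤ Filter.liminf (fun n => ∫⁻ x, ENNReal.ofReal (F n x) ∂μ) Filter.atTop :=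
        lintegral_liminf_le' fun n => (hF n).aemeasurable.ennreal_ofReal
    _ ≤ Filter.liminf (fun n => ENNReal.ofReal (c n)) Filter.atTop := by
        refine Filter.liminf_le_liminf (Filter.Eventually.of_forall fun n => ?_)
        change _ ≤ ENNReal.ofReal (c n)
        rw [← ofReal_integral_eq_lintegral_ofReal (hF n) (Filter.Eventually.of_forall (hF0 n))]
        exact ENNReal.ofReal_le_ofReal (hc n)
    _ = ENNReal.ofReal C := ((ENNReal.continuous_ofReal.tendsto _).comp hC).liminf_eq

/-! ### The weighted Korn inequality -/

/-- The density of the squared norm of `H¹₀` at the point `x`, for a field with the value `v` and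
the gradient `p`. -/
def energyDensity (x : R3) (v : Fin 3 → ℝ) (p : Fin 3 → Fin 3 → ℝ) : ℝ :=
  ∑ i, v i ^ 2 * (rho x ^ 2)⁻¹ + entrySq p

theorem energyDensity_nonneg (x : R3) (v : Fin 3 → ℝ) (p : Fin 3 → Fin 3 → ℝ) :
    0 ≤ energyDensity x v p := by
  unfold energyDensity
  have := entrySq_nonneg p
  have := rho_pos x
  positivity

theorem symSq_le_entrySq (p : Fin 3 → Fin 3 → ℝ) : symSq p ≤ entrySq p := by
  simp only [entrySq, symSq, Fin.sum_univ_three]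
  linarith [sq_nonneg (p 0 1 - p 1 0), sq_nonneg (p 0 2 - p 2 0), sq_nonneg (p 1 2 - p 2 1)]

theorem continuous_inv_rho_sq : Continuous fun x : R3 => (rho x ^ 2)⁻¹ :=
  (continuous_rho.pow 2).inv₀ fun x => (pow_pos (rho_pos x) 2).ne'

theorem integrable_entrySq {p : R3 → Fin 3 → Fin 3 → ℝ} {μ : Measure R3}
    (hp : ∀ i j, MemLp (fun x => p x i j) 2 μ) : Integrable (fun x => entrySq (p x)) μ := by
  unfold entrySq
  exact integrable_finsetSum _ fun i _ => integrable_finsetSum _ fun j _ => (hp i j).integrable_sq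

theorem memLp_symPart {p : R3 → Fin 3 → Fin 3 → ℝ} {μ : Measure R3}
    (hp : ∀ i j, MemLp (fun x => p x i j) 2 μ) (i j : Fin 3) :
    MemLp (fun x => (p x i j + p x j i) / 2) 2 μ := by
  have := ((hp i j).add (hp j i)).const_mul (1 / 2 : ℝ)
  refine this.ae_eq (Filter.Eventually.of_forall fun x => ?_)
  simp only [Pi.add_apply]
  ring

theorem integrable_symSq {p : R3 → Fin 3 → Fin 3 → ℝ} {μ : Measure R3}
    (hp : ∀ i j, MemLp (fun x => p x i j) 2 μ) : Integrable (fun x => symSq (p x)) μ := by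
  unfold symSq
  exact integrable_finsetSum _ fun i _ => integrable_finsetSum _ fun j _ =>
    (memLp_symPart hp i j).integrable_sq

theorem integral_symSq {p : R3 → Fin 3 → Fin 3 → ℝ} {μ : Measure R3}
    (hp : ∀ i j, MemLp (fun x => p x i j) 2 μ) :
    ∫ x, symSq (p x) ∂μ = ∑ i, ∑ j, ∫ x, ((p x i j + p x j i) / 2) ^ 2 ∂μ := by
  unfold symSq
  rw [integral_finsetSum _ fun i _ => integrable_finsetSum _ fun j _ =>
    (memLp_symPart hp i j).integrable_sq]
  refine Finset.sum_congr rfl fun i _ => ?_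
  rw [integral_finsetSum _ fun j _ => (memLp_symPart hp i j).integrable_sq]

theorem integrable_energyDensity {v : R3 → Fin 3 → ℝ} {p : R3 → Fin 3 → Fin 3 → ℝ}
    (hv : ∀ i, Integrable (fun x => v x i ^ 2 * (rho x ^ 2)⁻¹) halfMeasure)
    (hp : ∀ i j, MemLp (fun x => p x i j) 2 halfMeasure) :
    Integrable (fun x => energyDensity x (v x) (p x)) halfMeasure := by
  unfold energyDensity
  exact (integrable_finsetSum _ fun i _ => hv i).add (integrable_entrySq hp)

/-- The weighted Korn inequality for smooth fields. -/
theorem weighted_korn_smooth : ∃ K : ℝ, 0 < K ∧ ∀ u : Fin 3 → R3 → ℝ,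
    (∀ i, ContDiff ℝ 2 (u i)) → (∀ i, HasCompactSupport (u i)) →
    Integrable (fun x => energyDensity x (fun i => u i x) (jac u x)) halfMeasure ∧
    ∫ x, energyDensity x (fun i => u i x) (jac u x) ∂halfMeasure ≤
      K * ∫ x, symSq (jac u x) ∂halfMeasure := by
  obtain ⟨K, hK, h⟩ := korn_half
  -- Hardy bounds the weighted term by `4 ∫ |∇u|²`; the gradient term adds one more.
  refine ⟨5 * K, by positivity, fun u hu hc => ?_⟩
  have hle : (1 : WithTop ℕ∞) ≤ 2 := by norm_num
  have hp : ∀ i j, MemLp (fun x => jac u x i j) 2 halfMeasure := fun i j =>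
    (continuous_partialDeriv ((hu i).of_le hle) j).memLp_of_hasCompactSupport
      (hasCompactSupport_partialDeriv (hc i) j)
  have hv : ∀ i, Integrable (fun x => u i x ^ 2 * (rho x ^ 2)⁻¹) halfMeasure := fun i =>
    (((hu i).continuous.pow 2).mul continuous_inv_rho_sq).integrable_of_hasCompactSupport
      (hasCompactSupport_sq (hc i)).mul_right
  refine ⟨integrable_energyDensity (v := fun x i => u i x) hv hp, ?_⟩
  have h1 : ∀ i, ∫ x, u i x ^ 2 * (rho x ^ 2)⁻¹ ∂halfMeasure ≤
      4 * ∫ x, ∑ j, jac u x i j ^ 2 ∂halfMeasure := fun i =>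
    hardy_half ((hu i).of_le hle) (hc i)
  have e1 : ∫ x, energyDensity x (fun i => u i x) (jac u x) ∂halfMeasure =
      (∑ i, ∫ x, u i x ^ 2 * (rho x ^ 2)⁻¹ ∂halfMeasure) +
        ∫ x, entrySq (jac u x) ∂halfMeasure := by
    unfold energyDensity
    rw [integral_add (integrable_finsetSum _ fun i _ => hv i) (integrable_entrySq hp),
      integral_finsetSum _ fun i _ => hv i]
  have e2 : ∫ x, entrySq (jac u x) ∂halfMeasure =
      ∑ i, ∫ x, ∑ j, jac u x i j ^ 2 ∂halfMeasure := by
    unfold entrySq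
    rw [integral_finsetSum _ fun i _ => integrable_finsetSum _ fun j _ => (hp i j).integrable_sq]
  have h2 : ∑ i, ∫ x, u i x ^ 2 * (rho x ^ 2)⁻¹ ∂halfMeasure ≤
      4 * ∫ x, entrySq (jac u x) ∂halfMeasure := by
    rw [e2, Finset.mul_sum]
    exact Finset.sum_le_sum fun i _ => h1 i
  rw [e1]
  linarith [h u hu hc]

/-- The weighted Korn inequality for fields of bounded support. -/
theorem weighted_korn_compact : ∃ K : ℝ, 0 < K ∧ ∀ (v : Fin 3 → R3 → ℝ)
    (p : R3 → Fin 3 → Fin 3 → ℝ), (∀ i, MemLp (v i) 2 halfMeasure) →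
    (∀ i, HasCompactSupport (v i)) → (∀ i j, MemLp (fun x => p x i j) 2 halfMeasure) →
    (∀ i j, HasWeakPartial j (v i) fun x => p x i j) →
    ∫ x, energyDensity x (fun i => v i x) (p x) ∂halfMeasure ≤
      K * ∫ x, symSq (p x) ∂halfMeasure := by
  obtain ⟨K, hK, h⟩ := weighted_korn_smooth
  refine ⟨K, hK, fun v p hv hc hp hw => ?_⟩
  let vn : ℕ → Fin 3 → R3 → ℝ := fun n i => mollify (kernel n) (v i)
  let pn : ℕ → R3 → Fin 3 → Fin 3 → ℝ := fun n x i j =>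
    mollify (kernel n) (fun y => p y i j) x
  have hk := isOneSidedKernel_kernel
  have hvn : ∀ n i, ContDiff ℝ 2 (vn n i) := fun n i =>
    contDiff_infty.1 (contDiff_mollify (hk n) (hv i)) 2
  have hvc : ∀ n i, HasCompactSupport (vn n i) := fun n i =>
    hasCompactSupport_mollify (hk n) (hc i)
  have hjac : ∀ n, ∀ᵐ x ∂halfMeasure, jac (vn n) x = pn n x := by
    intro n
    filter_upwards [ae_restrict_mem measurableSet_lowerHalfSpace] with x hx
    funext i j
    exact partialDeriv_mollify (hk n) (hv i) (hw i j) hx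
  have hpn : ∀ n i j, MemLp (fun x => pn n x i j) 2 halfMeasure := fun n i j =>
    (memLp_two_iff_integrable_sq
      (contDiff_mollify (hk n) (hp i j)).continuous.aestronglyMeasurable).2
      (integrable_mollify_sq (hk n) (hp i j)).integrableOn
  refine integral_le_of_ae_tendsto
    (F := fun n x => energyDensity x (fun i => vn n i x) (jac (vn n) x))
    (c := fun _ => K * ∫ x, symSq (p x) ∂halfMeasure)
    (fun n => (h _ (hvn n) (hvc n)).1) (fun n x => energyDensity_nonneg _ _ _) ?_
    (fun n => ?_) tendsto_const_nhds
  · have l1 := ae_all_iff.2 fun i => ae_tendsto_mollify (hv i)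
    have l2 := ae_all_iff.2 fun i => ae_all_iff.2 fun j => ae_tendsto_mollify (hp i j)
    filter_upwards [l1, l2, ae_all_iff.2 hjac] with x h1 h2 h3
    simp only [h3, energyDensity, entrySq]
    exact (tendsto_finsetSum _ fun i _ => ((h1 i).pow 2).mul_const _).add
      (tendsto_finsetSum _ fun i _ => tendsto_finsetSum _ fun j _ => (h2 i j).pow 2)
  · refine (h _ (hvn n) (hvc n)).2.trans (mul_le_mul_of_nonneg_left ?_ hK.le)
    have e1 : ∫ x, symSq (jac (vn n) x) ∂halfMeasure = ∫ x, symSq (pn n x) ∂halfMeasure := by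
      refine integral_congr_ae ?_
      filter_upwards [hjac n] with x hx
      rw [hx]
    rw [e1, integral_symSq (hpn n), integral_symSq hp]
    -- Mollification is linear, so it contracts the `L²` norm of each strain entry.
    refine Finset.sum_le_sum fun i _ => Finset.sum_le_sum fun j _ => ?_
    have e2 := integral_mollify_sq_le (hk n) (memLp_symPart hp i j)
    simp only [mollify_half_add (hk n) (hp i j) (hp j i)] at e2
    exact e2

/-! ### Cutoffs at infinity -/

theorem HasWeakPartial.mul_smooth {j : Fin 3} {f g χ : R3 → ℝ} (h : HasWeakPartial j f g)
    (hf : ∀ ψ : R3 → ℝ, Continuous ψ → HasCompactSupport ψ →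
      Integrable (fun x => f x * ψ x) halfMeasure)
    (hg : ∀ ψ : R3 → ℝ, Continuous ψ → HasCompactSupport ψ →
      Integrable (fun x => g x * ψ x) halfMeasure)
    (hχ : ContDiff ℝ ∞ χ) :
    HasWeakPartial j (fun x => χ x * f x) fun x => χ x * g x + f x * partialDeriv j χ x := by
  intro φ hφ
  have hχ1 : ContDiff ℝ 1 χ := hχ.of_le (by exact_mod_cast le_top)
  have hφ1 : ContDiff ℝ 1 φ := hφ.smooth.of_le (by exact_mod_cast le_top)
  have hT : IsTestFunction fun x => χ x * φ x :=
    ⟨hχ.mul hφ.smooth, hφ.compact.mul_left, (tsupport_mul_subset_right).trans hφ.support⟩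
  have e := h _ hT
  have hd : ∀ x, partialDeriv j (fun x => χ x * φ x) x =
      partialDeriv j χ x * φ x + χ x * partialDeriv j φ x := fun x =>
    partialDeriv_mul (hχ1.differentiable one_ne_zero x) (hφ1.differentiable one_ne_zero x) j
  have i1 := hf (fun x => partialDeriv j χ x * φ x)
    ((continuous_partialDeriv hχ1 j).mul hφ1.continuous) hφ.compact.mul_left
  have i2 := hf (fun x => χ x * partialDeriv j φ x)
    (hχ.continuous.mul (continuous_partialDeriv hφ1 j))
    (hasCompactSupport_partialDeriv hφ.compact j).mul_left
  have i3 := hg (fun x => χ x * φ x) (hχ.continuous.mul hφ1.continuous) hφ.compact.mul_left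
  have e1 : ∫ x, f x * partialDeriv j (fun x => χ x * φ x) x ∂halfMeasure =
      ∫ x, f x * (partialDeriv j χ x * φ x) ∂halfMeasure +
        ∫ x, f x * (χ x * partialDeriv j φ x) ∂halfMeasure := by
    rw [← integral_add i1 i2]
    congr 1
    funext x
    rw [hd]
    ring
  have e2 : ∫ x, (χ x * g x + f x * partialDeriv j χ x) * φ x ∂halfMeasure =
      ∫ x, g x * (χ x * φ x) ∂halfMeasure +
        ∫ x, f x * (partialDeriv j χ x * φ x) ∂halfMeasure := by
    rw [← integral_add i3 i1]
    congr 1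
    funext x
    ring
  have e3 : ∫ x, χ x * f x * partialDeriv j φ x ∂halfMeasure =
      ∫ x, f x * (χ x * partialDeriv j φ x) ∂halfMeasure := by
    congr 1
    funext x
    ring
  rw [e2, e3]
  linarith

/-- A smooth function that is `1` near the origin. -/
def cutoffBump : ContDiffBump (0 : R3) where
  rIn := 1
  rOut := 2
  rIn_pos := one_pos
  rIn_lt_rOut := one_lt_two

/-- Smooth cutoff functions equal to `1` on larger and larger balls. -/
def cutoff (n : ℕ) (x : R3) : ℝ := cutoffBump (((n : ℝ) + 1)⁻¹ • x)

theorem contDiff_cutoff (n : ℕ) : ContDiff ℝ ∞ (cutoff n) :=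
  cutoffBump.contDiff.comp (contDiff_const_smul _)

theorem hasCompactSupport_cutoff (n : ℕ) : HasCompactSupport (cutoff n) :=
  cutoffBump.hasCompactSupport.comp_smul (by positivity)

theorem abs_cutoff_le_one (n : ℕ) (x : R3) : |cutoff n x| ≤ 1 := by
  rw [cutoff, abs_of_nonneg cutoffBump.nonneg]
  exact cutoffBump.le_one

theorem eventually_cutoff_eventuallyEq (x : R3) :
    ∀ᶠ n in Filter.atTop, cutoff n =ᶠ[nhds x] fun _ => 1 := by
  obtain ⟨N, hN⟩ := exists_nat_gt ‖x‖
  filter_upwards [Filter.eventually_ge_atTop N] with n hn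
  have hn' : (N : ℝ) ≤ n := by exact_mod_cast hn
  have : ∀ᶠ y in nhds x, ‖y‖ < (n : ℝ) + 1 :=
    continuous_norm.continuousAt.eventually_lt continuousAt_const (by linarith)
  filter_upwards [this] with y hy
  refine cutoffBump.one_of_mem_closedBall ?_
  have h0 : (0 : ℝ) < (n : ℝ) + 1 := by positivity
  rw [mem_closedBall_zero_iff, norm_smul, Real.norm_of_nonneg (by positivity)]
  change _ ≤ (1 : ℝ)
  rw [inv_mul_le_iff₀ h0]
  linarith

theorem partialDeriv_cutoff (n : ℕ) (j : Fin 3) (x : R3) : partialDeriv j (cutoff n) x =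
    ((n : ℝ) + 1)⁻¹ * partialDeriv j cutoffBump (((n : ℝ) + 1)⁻¹ • x) := by
  have h : HasFDerivAt (fun x : R3 => ((n : ℝ) + 1)⁻¹ • x)
      (((n : ℝ) + 1)⁻¹ • ContinuousLinearMap.id ℝ R3) x :=
    (((n : ℝ) + 1)⁻¹ • ContinuousLinearMap.id ℝ R3).hasFDerivAt
  have h2 := ((cutoffBump.contDiff.differentiable (n := 1) one_ne_zero
    (((n : ℝ) + 1)⁻¹ • x)).hasFDerivAt.comp x h).fderiv
  change fderiv ℝ (cutoffBump ∘ fun x : R3 => ((n : ℝ) + 1)⁻¹ • x) x _ = _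
  rw [h2]
  simp [partialDeriv]

/-- Rescaling by `R = n + 1` gains `R⁻¹` in the derivative, while `ϱ(x) ≤ R ϱ(x/R)` since `R ≥ 1`.
The product is bounded by its value for the fixed bump at `x/R`, uniformly in `n`. -/
theorem exists_partialDeriv_cutoff_bound : ∃ B : ℝ, 0 ≤ B ∧ ∀ (n : ℕ) (j : Fin 3) (x : R3),
    |partialDeriv j (cutoff n) x| * rho x ≤ B := by
  have hc : ∀ j, ∃ B : ℝ, ∀ y, ‖partialDeriv j cutoffBump y * rho y‖ ≤ B := fun j =>
    ((hasCompactSupport_partialDeriv cutoffBump.hasCompactSupport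
      j).mul_right).exists_bound_of_continuous
      ((continuous_partialDeriv cutoffBump.contDiff j).mul continuous_rho)
  choose B hB using hc
  have hB0 : ∀ j, 0 ≤ B j := fun j => (norm_nonneg _).trans (hB j 0)
  refine ⟨∑ j, B j, Finset.sum_nonneg fun j _ => hB0 j, fun n j x => ?_⟩
  refine le_trans ?_ (Finset.single_le_sum (fun j _ => hB0 j) (Finset.mem_univ j))
  have h0 : (1 : ℝ) ≤ (n : ℝ) + 1 := by
    have : (0 : ℝ) ≤ n := n.cast_nonneg
    linarith
  set R := (n : ℝ) + 1
  have hR : 0 < R := one_pos.trans_le h0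
  have hρ : R⁻¹ * rho x ≤ rho (R⁻¹ • x) := by
    have h1 : (R⁻¹) ^ 2 ≤ 1 := pow_le_one₀ (by positivity) (inv_le_one_of_one_le₀ h0)
    rw [rho, rho]
    refine Real.le_sqrt_of_sq_le ?_
    rw [mul_pow, Real.sq_sqrt (by positivity), norm_smul, mul_pow,
      Real.norm_of_nonneg (by positivity)]
    nlinarith
  refine le_trans ?_ (hB j (R⁻¹ • x))
  rw [partialDeriv_cutoff, abs_mul, abs_of_pos (inv_pos.2 hR), norm_mul, Real.norm_eq_abs,
    Real.norm_of_nonneg (rho_pos _).le, mul_comm R⁻¹, mul_assoc]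
  exact mul_le_mul_of_nonneg_left hρ (abs_nonneg _)

/-- Provides a majorant independent of the cutoff index: the commutator term `v ⊗ ∇χ` is dominated
by the weighted density `v²/ϱ²`. -/
theorem symSq_cutoff_le {χ ρ B : ℝ} {b v : Fin 3 → ℝ} {p : Fin 3 → Fin 3 → ℝ} (hρ : 0 < ρ)
    (hχ : |χ| ≤ 1) (hb : ∀ j, |b j| * ρ ≤ B) :
    symSq (fun i j => χ * p i j + v i * b j) ≤
      ∑ i, ∑ j : Fin 3, (2 * p i j ^ 2 + 2 * B ^ 2 * (v i ^ 2 * (ρ ^ 2)⁻¹)) := by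
  refine (symSq_le_entrySq _).trans ?_
  refine Finset.sum_le_sum fun i _ => Finset.sum_le_sum fun j _ => ?_
  have h1 : χ ^ 2 ≤ 1 := (sq_le_one_iff_abs_le_one χ).2 hχ
  have h2 : b j ^ 2 * ρ ^ 2 ≤ B ^ 2 := by
    have := pow_le_pow_left₀ (by positivity) (hb j) 2
    rwa [mul_pow, sq_abs] at this
  have h3 : b j ^ 2 ≤ B ^ 2 * (ρ ^ 2)⁻¹ := by
    rw [← div_eq_mul_inv, le_div_iff₀ (by positivity)]
    exact h2
  nlinarith [sq_nonneg (χ * p i j - v i * b j), mul_le_mul_of_nonneg_right h1 (sq_nonneg (p i j)),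
    mul_le_mul_of_nonneg_left h3 (sq_nonneg (v i))]

/-- The weighted Korn inequality. -/
theorem weighted_korn : ∃ K : ℝ, 0 < K ∧ ∀ (v : Fin 3 → R3 → ℝ)
    (p : R3 → Fin 3 → Fin 3 → ℝ), (∀ i, MemLp (fun x => v i x * (rho x)⁻¹) 2 halfMeasure) →
    (∀ i j, MemLp (fun x => p x i j) 2 halfMeasure) →
    (∀ i j, HasWeakPartial j (v i) fun x => p x i j) →
    ∫ x, energyDensity x (fun i => v i x) (p x) ∂halfMeasure ≤
      K * ∫ x, symSq (p x) ∂halfMeasure := by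
  obtain ⟨K, hK, h⟩ := weighted_korn_compact
  obtain ⟨B, hB0, hB⟩ := exists_partialDeriv_cutoff_bound
  refine ⟨K, hK, fun v p hv hp hw => ?_⟩
  have hχ1 : ∀ n, ContDiff ℝ 1 (cutoff n) := fun n =>
    (contDiff_cutoff n).of_le (by exact_mod_cast le_top)
  have hrho : ∀ x, (rho x)⁻¹ * rho x = 1 := fun x => inv_mul_cancel₀ (rho_pos x).ne'
  have hvψ : ∀ i, ∀ ψ : R3 → ℝ, Continuous ψ → HasCompactSupport ψ →
      MemLp (fun x => v i x * ψ x) 2 halfMeasure := by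
    intro i ψ hψ hc
    -- On the support of `ψ` the weight is harmless: write `v ψ = (v ϱ⁻¹)(ϱ ψ)`.
    have h1 : MemLp (fun x => rho x * ψ x) ∞ halfMeasure :=
      (continuous_rho.mul hψ).memLp_of_hasCompactSupport hc.mul_left
    refine (h1.mul (r := 2) (hv i)).ae_eq (Filter.Eventually.of_forall fun x => ?_)
    simp only [Pi.mul_apply]
    rw [mul_assoc, ← mul_assoc (rho x)⁻¹, hrho, one_mul]
  have hvi : ∀ i, ∀ ψ : R3 → ℝ, Continuous ψ → HasCompactSupport ψ →
      Integrable (fun x => v i x * ψ x) halfMeasure := by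
    intro i ψ hψ hc
    have h1 : MemLp (fun x => rho x * ψ x) 2 halfMeasure :=
      (continuous_rho.mul hψ).memLp_of_hasCompactSupport hc.mul_left
    refine ((hv i).integrable_mul (q := 2) h1).congr (Filter.Eventually.of_forall fun x => ?_)
    simp only [Pi.mul_apply]
    rw [mul_assoc, ← mul_assoc (rho x)⁻¹, hrho, one_mul]
  have hpi : ∀ i j, ∀ ψ : R3 → ℝ, Continuous ψ → HasCompactSupport ψ →
      Integrable (fun x => p x i j * ψ x) halfMeasure := fun i j ψ hψ hc =>
    (hp i j).integrable_mul (q := 2) (hψ.memLp_of_hasCompactSupport hc)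
  let vn : ℕ → Fin 3 → R3 → ℝ := fun n i x => cutoff n x * v i x
  let pn : ℕ → R3 → Fin 3 → Fin 3 → ℝ := fun n x i j =>
    cutoff n x * p x i j + v i x * partialDeriv j (cutoff n) x
  have hvn : ∀ n i, MemLp (vn n i) 2 halfMeasure := fun n i => by
    simpa only [vn, mul_comm (cutoff n _)] using
      hvψ i _ (contDiff_cutoff n).continuous (hasCompactSupport_cutoff n)
  have hvnc : ∀ n i, HasCompactSupport (vn n i) := fun n i =>
    (hasCompactSupport_cutoff n).mul_right
  have hpn : ∀ n i j, MemLp (fun x => pn n x i j) 2 halfMeasure := by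
    intro n i j
    have h1 : MemLp (cutoff n) ∞ halfMeasure :=
      (contDiff_cutoff n).continuous.memLp_of_hasCompactSupport (hasCompactSupport_cutoff n)
    exact ((hp i j).mul (r := 2) h1).add (hvψ i _ (continuous_partialDeriv (hχ1 n) j)
      (hasCompactSupport_partialDeriv (hasCompactSupport_cutoff n) j))
  have hwn : ∀ n i j, HasWeakPartial j (vn n i) fun x => pn n x i j := fun n i j =>
    (hw i j).mul_smooth (hvi i) (hpi i j) (contDiff_cutoff n)
  have hv2 : ∀ i, Integrable (fun x => v i x ^ 2 * (rho x ^ 2)⁻¹) halfMeasure := fun i => by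
    simpa only [mul_pow, inv_pow] using (hv i).integrable_sq
  have hvn2 : ∀ n i, Integrable (fun x => vn n i x ^ 2 * (rho x ^ 2)⁻¹) halfMeasure := by
    intro n i
    have hi := (hvn n i).integrable_sq
    refine hi.mono (hi.aestronglyMeasurable.mul
      continuous_inv_rho_sq.aestronglyMeasurable) (Filter.Eventually.of_forall fun x => ?_)
    rw [norm_mul]
    refine mul_le_of_le_one_right (norm_nonneg _) ?_
    rw [Real.norm_of_nonneg (inv_nonneg.2 (sq_nonneg _))]
    exact inv_le_one_of_one_le₀ (one_le_rho_sq x)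
  have hev : ∀ x, ∀ᶠ n in Filter.atTop, (∀ i, vn n i x = v i x) ∧ pn n x = p x := by
    intro x
    filter_upwards [eventually_cutoff_eventuallyEq x] with n hn
    have h1 : cutoff n x = 1 := hn.self_of_nhds
    have h2 : ∀ j, partialDeriv j (cutoff n) x = 0 := fun j => by
      rw [partialDeriv, hn.fderiv_eq]
      simp
    refine ⟨fun i => by simp [vn, h1], ?_⟩
    funext i j
    simp [pn, h1, h2]
  refine integral_le_of_ae_tendsto
    (F := fun n x => energyDensity x (fun i => vn n i x) (pn n x))
    (c := fun n => K * ∫ x, symSq (pn n x) ∂halfMeasure)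
    (fun n => integrable_energyDensity (v := fun x i => vn n i x) (hvn2 n) (hpn n))
    (fun n x => energyDensity_nonneg _ _ _)
    (Filter.Eventually.of_forall fun x => ?_)
    (fun n => h _ _ (hvn n) (hvnc n) (hpn n) (hwn n)) (Filter.Tendsto.const_mul K ?_)
  · refine tendsto_const_nhds.congr' ?_
    filter_upwards [hev x] with n hn
    rw [hn.2, funext hn.1]
  -- The truncated gradient at each point eventually equals `p`, and the majorant is integrable
  -- because `v ϱ⁻¹` and `p` are square integrable.
  · refine tendsto_integral_of_dominated_convergence
      (fun x => ∑ i, ∑ j : Fin 3, (2 * p x i j ^ 2 + 2 * B ^ 2 * (v i x ^ 2 * (rho x ^ 2)⁻¹)))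
      (fun n => (integrable_symSq (hpn n)).aestronglyMeasurable) ?_ (fun n => ?_)
      (Filter.Eventually.of_forall fun x => ?_)
    · exact integrable_finsetSum _ fun i _ => integrable_finsetSum _ fun j _ =>
        ((hp i j).integrable_sq.const_mul 2).add ((hv2 i).const_mul _)
    · refine Filter.Eventually.of_forall fun x => ?_
      rw [Real.norm_of_nonneg (symSq_nonneg _)]
      exact symSq_cutoff_le (rho_pos x) (abs_cutoff_le_one n x) fun j => hB n j x
    · refine tendsto_const_nhds.congr' ?_
      filter_upwards [hev x] with n hn
      rw [hn.2]

/-! ### The Hilbert space `H¹₀` -/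

theorem integral_weightedMeasure (g : R3 → ℝ) :
    ∫ x, g x ∂weightedMeasure = ∫ x, g x * (rho x ^ 2)⁻¹ ∂halfMeasure := by
  rw [weightedMeasure, integral_withDensity_eq_integral_toReal_smul
    continuous_inv_rho_sq.measurable.ennreal_ofReal
    (Filter.Eventually.of_forall fun _ => ENNReal.ofReal_lt_top)]
  congr 1
  funext x
  rw [ENNReal.toReal_ofReal (inv_nonneg.2 (sq_nonneg _)), smul_eq_mul, mul_comm]

/-- The functional is the inner product with `ψ ϱ² eᵢ`; the factor `ϱ²` undoes the weight of the
measure. -/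
theorem continuous_integral_weighted_mul (i : Fin 3) {ψ : R3 → ℝ} (hψ : Continuous ψ)
    (hc : HasCompactSupport ψ) :
    Continuous fun u : Lp R3 2 weightedMeasure => ∫ x, u x i * ψ x ∂halfMeasure := by
  have h1 : MemLp (fun x => (ψ x * rho x ^ 2) • (EuclideanSpace.single i 1 : R3)) 2
      weightedMeasure :=
    ((hψ.mul (continuous_rho.pow 2)).smul continuous_const).memLp_of_hasCompactSupport
      (hc.mul_right.smul_right)
  have h2 : ∀ u : Lp R3 2 weightedMeasure,
      inner ℝ (h1.toLp _) u = ∫ x, u x i * ψ x ∂halfMeasure := by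
    intro u
    rw [L2.inner_def]
    have e : ∫ x, inner ℝ (h1.toLp _ x) (u x) ∂weightedMeasure =
        ∫ x, ψ x * rho x ^ 2 * u x i ∂weightedMeasure := by
      refine integral_congr_ae ?_
      filter_upwards [h1.coeFn_toLp] with x hx
      rw [hx, real_inner_smul_left, EuclideanSpace.inner_single_left]
      simp
    rw [e, integral_weightedMeasure]
    congr 1
    funext x
    have := (rho_pos x).ne'
    field_simp
  simp only [← h2]
  exact continuous_const.inner continuous_id

theorem continuous_integral_tensor_mul (k : Fin 3 × Fin 3) {ψ : R3 → ℝ} (hψ : Continuous ψ)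
    (hc : HasCompactSupport ψ) :
    Continuous fun G : Lp Tensor2 2 halfMeasure => ∫ x, G x k * ψ x ∂halfMeasure := by
  have h1 : MemLp (fun x => ψ x • (EuclideanSpace.single k 1 : Tensor2)) 2 halfMeasure :=
    (hψ.smul continuous_const).memLp_of_hasCompactSupport hc.smul_right
  have h2 : ∀ G : Lp Tensor2 2 halfMeasure,
      inner ℝ (h1.toLp _) G = ∫ x, G x k * ψ x ∂halfMeasure := by
    intro G
    rw [L2.inner_def]
    refine integral_congr_ae ?_
    filter_upwards [h1.coeFn_toLp] with x hx
    rw [hx, real_inner_smul_left, EuclideanSpace.inner_single_left]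
    simp [mul_comm]
  simp only [← h2]
  exact continuous_const.inner continuous_id

/-- Each test function imposes an equation between continuous functionals. Closedness gives the
completeness that Lax–Milgram needs. -/
theorem isClosed_H10 : IsClosed (H10 : Set GraphSpace) := by
  have e : (H10 : Set GraphSpace) = ⋂ (i : Fin 3) (j : Fin 3) (φ : R3 → ℝ)
      (_ : IsTestFunction φ), {w : GraphSpace |
        ∫ x, w.fst x i * partialDeriv j φ x ∂halfMeasure =
          -∫ x, w.snd x (i, j) * φ x ∂halfMeasure} := by
    ext w
    simp only [Set.mem_iInter]
    rfl
  rw [e]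
  refine isClosed_iInter fun i => isClosed_iInter fun j => isClosed_iInter fun φ =>
    isClosed_iInter fun hφ => isClosed_eq ?_ ?_
  · exact (continuous_integral_weighted_mul i (hφ.continuous_partialDeriv j)
      (hφ.hasCompactSupport_partialDeriv j)).comp (continuous_fst.comp (WithLp.prod_continuous_ofLp 2 _ _))
  · exact ((continuous_integral_tensor_mul (i, j) hφ.smooth.continuous hφ.compact).comp
      (continuous_snd.comp (WithLp.prod_continuous_ofLp 2 _ _))).neg

instance : CompleteSpace H10 := isClosed_H10.completeSpace_coe

/-- The matrix of distributional derivatives `∂ⱼ uᵢ`. -/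
def gradEntries (u : H10) (x : R3) : Fin 3 → Fin 3 → ℝ :=
  fun i j => (u : GraphSpace).snd x (i, j)

theorem memLp_gradEntries (u : H10) (i j : Fin 3) :
    MemLp (fun x => gradEntries u x i j) 2 halfMeasure :=
  (EuclideanSpace.proj (𝕜 := ℝ) (i, j)).comp_memLp' (Lp.memLp (u : GraphSpace).snd)

theorem L2_norm_sq_eq {α E : Type*} [MeasurableSpace α] {μ : Measure α} [NormedAddCommGroup E]
    [InnerProductSpace ℝ E] (f : Lp E 2 μ) : ‖f‖ ^ 2 = ∫ x, ‖f x‖ ^ 2 ∂μ := by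
  rw [← real_inner_self_eq_norm_sq, L2.inner_def]
  simp only [real_inner_self_eq_norm_sq]

theorem memLp_displacement (u : H10) (i : Fin 3) :
    MemLp (fun x => H10.displacement u x i * (rho x)⁻¹) 2 halfMeasure := by
  have h1 : MemLp (fun x => H10.displacement u x i) 2 weightedMeasure :=
    (EuclideanSpace.proj (𝕜 := ℝ) i).comp_memLp' (Lp.memLp (H10.displacement u))
  have hm : AEStronglyMeasurable (fun x => H10.displacement u x i) halfMeasure :=
    h1.aestronglyMeasurable.mono_ac halfMeasure_ac
  have hr : Continuous fun x : R3 => (rho x)⁻¹ := continuous_rho.inv₀ fun x => (rho_pos x).ne'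
  refine (memLp_two_iff_integrable_sq (hm.mul hr.aestronglyMeasurable)).2 ?_
  have h2 := (integrable_withDensity_iff_integrable_smul' (μ := halfMeasure)
    continuous_inv_rho_sq.measurable.ennreal_ofReal
    (Filter.Eventually.of_forall fun _ => ENNReal.ofReal_lt_top)).1 h1.integrable_sq
  refine h2.congr (Filter.Eventually.of_forall fun x => ?_)
  simp only [ENNReal.toReal_ofReal (inv_nonneg.2 (sq_nonneg (rho x))), smul_eq_mul, Pi.mul_apply]
  rw [mul_pow, inv_pow, mul_comm]

theorem norm_sq_eq (u : H10) : ‖u‖ ^ 2 =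
    ∫ x, energyDensity x (fun i => H10.displacement u x i) (gradEntries u x) ∂halfMeasure := by
  have h1 : ‖u‖ ^ 2 = ‖(u : GraphSpace).fst‖ ^ 2 + ‖(u : GraphSpace).snd‖ ^ 2 :=
    WithLp.prod_norm_sq_eq_of_L2 (u : GraphSpace)
  rw [h1, L2_norm_sq_eq, L2_norm_sq_eq, integral_weightedMeasure]
  unfold energyDensity
  rw [integral_add _ (integrable_entrySq (memLp_gradEntries u))]
  · congr 1
    · congr 1
      funext x
      rw [EuclideanSpace.real_norm_sq_eq, Finset.sum_mul]
      rfl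
    · congr 1
      funext x
      rw [EuclideanSpace.real_norm_sq_eq, Fintype.sum_prod_type]
      rfl
  · refine integrable_finsetSum _ fun i _ => ?_
    simpa only [mul_pow, inv_pow] using (memLp_displacement u i).integrable_sq

theorem korn_H10 : ∃ K : ℝ, 0 < K ∧ ∀ u : H10,
    ‖u‖ ^ 2 ≤ K * ∫ x, symSq (gradEntries u x) ∂halfMeasure := by
  obtain ⟨K, hK, h⟩ := weighted_korn
  refine ⟨K, hK, fun u => ?_⟩
  rw [norm_sq_eq]
  exact h _ _ (memLp_displacement u) (memLp_gradEntries u) fun i j => u.2 i j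

/-! ### The Lamé form -/

/-- The isotropic quadratic form of two matrices, through their symmetric parts. -/
def lameDensity (l m : ℝ) (p q : Fin 3 → Fin 3 → ℝ) : ℝ :=
  l * ((∑ i, p i i) * ∑ i, q i i) +
    2 * m * ∑ i, ∑ j, (p i j + p j i) / 2 * ((q i j + q j i) / 2)

theorem lameDensity_comm (l m : ℝ) (p q : Fin 3 → Fin 3 → ℝ) :
    lameDensity l m p q = lameDensity l m q p := by
  simp only [lameDensity]
  rw [mul_comm (∑ i, p i i)]
  simp only [mul_comm ((p _ _ + p _ _) / 2)]

theorem lameDensity_add_left (l m : ℝ) (p p' q : Fin 3 → Fin 3 → ℝ) :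
    lameDensity l m (p + p') q = lameDensity l m p q + lameDensity l m p' q := by
  simp only [lameDensity, Fin.sum_univ_three, Pi.add_apply]
  ring

theorem lameDensity_smul_left (l m c : ℝ) (p q : Fin 3 → Fin 3 → ℝ) :
    lameDensity l m (c • p) q = c * lameDensity l m p q := by
  simp only [lameDensity, Fin.sum_univ_three, Pi.smul_apply, smul_eq_mul]
  ring

theorem doubleDot_elasticityTensor (l m : ℝ) (u v : H10) (x : R3) :
    doubleDot (elasticityTensor l m (H10.strain u x)) (H10.strain v x) =
      lameDensity l m (gradEntries u x) (gradEntries v x) := by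
  simp [doubleDot, elasticityTensor, H10.strain, H10.grad, lameDensity, gradEntries,
    Fin.sum_univ_three, Matrix.trace, Matrix.one_apply]
  ring

theorem lameForm_eq (lam mu : R3 → ℝ) (u v : H10) : lameForm lam mu u v =
    ∫ x, lameDensity (lam x) (mu x) (gradEntries u x) (gradEntries v x) ∂halfMeasure := by
  simp only [lameForm, doubleDot_elasticityTensor]

theorem trace_sq_le_symSq (p : Fin 3 → Fin 3 → ℝ) : (∑ i, p i i) ^ 2 ≤ 3 * symSq p := by
  simp only [symSq, Fin.sum_univ_three]
  nlinarith [sq_nonneg (p 0 0 - p 1 1), sq_nonneg (p 0 0 - p 2 2), sq_nonneg (p 1 1 - p 2 2),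
    sq_nonneg (p 0 1 + p 1 0), sq_nonneg (p 0 2 + p 2 0), sq_nonneg (p 1 2 + p 2 1)]

theorem abs_lameDensity_le {l m M : ℝ} (hl : |l| ≤ M) (hm : |m| ≤ M)
    (p q : Fin 3 → Fin 3 → ℝ) :
    |lameDensity l m p q| ≤ 3 * M * (entrySq p + entrySq q) := by
  have hM : 0 ≤ M := (abs_nonneg l).trans hl
  have h1 : |(∑ i, p i i) * ∑ i, q i i| ≤ 3 / 2 * (symSq p + symSq q) := by
    rw [abs_le]
    constructor <;> nlinarith [trace_sq_le_symSq p, trace_sq_le_symSq q,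
      sq_nonneg ((∑ i, p i i) + ∑ i, q i i), sq_nonneg ((∑ i, p i i) - ∑ i, q i i)]
  have h2 : |∑ i, ∑ j, (p i j + p j i) / 2 * ((q i j + q j i) / 2)| ≤
      1 / 2 * (symSq p + symSq q) := by
    refine (Finset.abs_sum_le_sum_abs _ _).trans ?_
    rw [symSq, symSq, ← Finset.sum_add_distrib, Finset.mul_sum]
    refine Finset.sum_le_sum fun i _ => (Finset.abs_sum_le_sum_abs _ _).trans ?_
    rw [← Finset.sum_add_distrib, Finset.mul_sum]
    refine Finset.sum_le_sum fun j _ => ?_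
    set a := (p i j + p j i) / 2
    set b := (q i j + q j i) / 2
    rw [abs_le]
    constructor <;> nlinarith [sq_nonneg (a + b), sq_nonneg (a - b)]
  have h3 := symSq_le_entrySq p
  have h4 := symSq_le_entrySq q
  have h5 := symSq_nonneg p
  have h6 := symSq_nonneg q
  calc |lameDensity l m p q| ≤ |l| * |(∑ i, p i i) * ∑ i, q i i| + 2 * |m| *
        |∑ i, ∑ j, (p i j + p j i) / 2 * ((q i j + q j i) / 2)| := by
        refine (abs_add_le _ _).trans (le_of_eq ?_)
        rw [abs_mul l, abs_mul (2 * m), abs_mul 2 m, abs_two]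
    _ ≤ M * (3 / 2 * (symSq p + symSq q)) + 2 * M * (1 / 2 * (symSq p + symSq q)) := by
        gcongr
    _ ≤ 3 * M * (entrySq p + entrySq q) := by nlinarith

/-- With `E = sym p`, split off the trace: the density is `2m (|E|² - (tr E)²/3) + (3l + 2m) (tr
E)²/3`. Both quadratic forms are nonnegative and add up to `|E|²`. -/
theorem le_lameDensity_self {l m α₀ β₀ : ℝ} (hm : α₀ ≤ m) (hl : β₀ ≤ 3 * l + 2 * m)
    (p : Fin 3 → Fin 3 → ℝ) : min (2 * α₀) β₀ * symSq p ≤ lameDensity l m p p := by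
  have h1 := trace_sq_le_symSq p
  have h2 : lameDensity l m p p = l * (∑ i, p i i) ^ 2 + 2 * m * symSq p := by
    simp only [lameDensity, symSq, pow_two]
  rw [h2]
  have h3 := min_le_left (2 * α₀) β₀
  have h4 := min_le_right (2 * α₀) β₀
  nlinarith [mul_nonneg (by linarith : 0 ≤ 2 * m - min (2 * α₀) β₀) (sub_nonneg.2 h1),
    mul_nonneg (by linarith : 0 ≤ 3 * l + 2 * m - min (2 * α₀) β₀) (sq_nonneg (∑ i, p i i))]

theorem ae_abs_le_of_c01Norm_le {g : R3 → ℝ} {M : ℝ} (hM : 0 ≤ M)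
    (h : c01Norm g ≤ ENNReal.ofReal M) : ∀ᵐ x ∂halfMeasure, |g x| ≤ M := by
  have h1 : eLpNorm g ∞ halfMeasure ≤ ENNReal.ofReal M := le_self_add.trans h
  rw [eLpNorm_exponent_top] at h1
  filter_upwards [ae_le_eLpNormEssSup (f := g) (μ := halfMeasure)] with x hx
  have h2 := hx.trans h1
  rwa [← ofReal_norm, ENNReal.ofReal_le_ofReal_iff hM, Real.norm_eq_abs] at h2

theorem aemeasurable_of_lipschitzOnWith {g : R3 → ℝ} {K : ℝ≥0}
    (h : LipschitzOnWith K g lowerHalfSpace) : AEMeasurable g halfMeasure :=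
  h.continuousOn.aemeasurable measurableSet_lowerHalfSpace

theorem LipschitzModuli.ae_bound {M : ℝ} (hM : 0 ≤ M) {lam mu : R3 → ℝ}
    (h : LipschitzModuli M lam mu) : ∀ᵐ x ∂halfMeasure, |lam x| ≤ M ∧ |mu x| ≤ M := by
  filter_upwards [ae_abs_le_of_c01Norm_le hM (le_add_self.trans h.bound),
    ae_abs_le_of_c01Norm_le hM (le_self_add.trans h.bound)] with x h1 h2
  exact ⟨h1, h2⟩

theorem integrable_lameDensity {M : ℝ} (hM : 0 ≤ M) {lam mu : R3 → ℝ}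
    (h : LipschitzModuli M lam mu) (u v : H10) :
    Integrable (fun x => lameDensity (lam x) (mu x) (gradEntries u x) (gradEntries v x))
      halfMeasure := by
  obtain ⟨_, hl⟩ := h.lipschitz_lam
  obtain ⟨_, hm⟩ := h.lipschitz_mu
  have ml := aemeasurable_of_lipschitzOnWith hl
  have mm := aemeasurable_of_lipschitzOnWith hm
  have mu' : ∀ i j, AEMeasurable (fun x => gradEntries u x i j) halfMeasure := fun i j =>
    (memLp_gradEntries u i j).aestronglyMeasurable.aemeasurable
  have mv : ∀ i j, AEMeasurable (fun x => gradEntries v x i j) halfMeasure := fun i j =>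
    (memLp_gradEntries v i j).aestronglyMeasurable.aemeasurable
  have i1 := ((integrable_entrySq (memLp_gradEntries u)).add
    (integrable_entrySq (memLp_gradEntries v))).const_mul (3 * M)
  refine i1.mono' ?_ ?_
  · refine AEMeasurable.aestronglyMeasurable ?_
    unfold lameDensity
    refine (ml.mul ((Finset.aemeasurable_fun_sum _ fun i _ => mu' i i).mul
      (Finset.aemeasurable_fun_sum _ fun i _ => mv i i))).add ((mm.const_mul 2).mul
      (Finset.aemeasurable_fun_sum _ fun i _ => Finset.aemeasurable_fun_sum _ fun j _ => ?_))
    exact (((mu' i j).add (mu' j i)).div_const 2).mul (((mv i j).add (mv j i)).div_const 2)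
  · filter_upwards [h.ae_bound hM] with x hx
    exact abs_lameDensity_le hx.1 hx.2 _ _

theorem gradEntries_add (u v : H10) :
    ∀ᵐ x ∂halfMeasure, gradEntries (u + v) x = gradEntries u x + gradEntries v x := by
  filter_upwards [Lp.coeFn_add (u : GraphSpace).snd (v : GraphSpace).snd] with x hx
  funext i j
  exact congrArg (fun t : Tensor2 => t (i, j)) hx

theorem gradEntries_smul (c : ℝ) (u : H10) :
    ∀ᵐ x ∂halfMeasure, gradEntries (c • u) x = c • gradEntries u x := by
  filter_upwards [Lp.coeFn_smul c (u : GraphSpace).snd] with x hx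
  funext i j
  exact congrArg (fun t : Tensor2 => t (i, j)) hx

theorem lameForm_comm (lam mu : R3 → ℝ) (u v : H10) :
    lameForm lam mu u v = lameForm lam mu v u := by
  simp only [lameForm_eq]
  congr 1
  funext x
  exact lameDensity_comm _ _ _ _

theorem lameForm_add_left {M : ℝ} (hM : 0 ≤ M) {lam mu : R3 → ℝ} (h : LipschitzModuli M lam mu)
    (u u' v : H10) :
    lameForm lam mu (u + u') v = lameForm lam mu u v + lameForm lam mu u' v := by
  simp only [lameForm_eq]
  rw [← integral_add (integrable_lameDensity hM h u v) (integrable_lameDensity hM h u' v)]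
  refine integral_congr_ae ?_
  filter_upwards [gradEntries_add u u'] with x hx
  rw [hx, lameDensity_add_left]

theorem lameForm_smul_left (lam mu : R3 → ℝ) (c : ℝ) (u v : H10) :
    lameForm lam mu (c • u) v = c * lameForm lam mu u v := by
  simp only [lameForm_eq]
  rw [← integral_const_mul]
  refine integral_congr_ae ?_
  filter_upwards [gradEntries_smul c u] with x hx
  rw [hx, lameDensity_smul_left]

theorem integral_entrySq_le (u : H10) :
    ∫ x, entrySq (gradEntries u x) ∂halfMeasure ≤ ‖u‖ ^ 2 := by
  rw [norm_sq_eq]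
  refine integral_mono (integrable_entrySq (memLp_gradEntries u))
    (integrable_energyDensity (v := fun x i => H10.displacement u x i) (fun i => by
      simpa only [mul_pow, inv_pow] using (memLp_displacement u i).integrable_sq)
      (memLp_gradEntries u)) fun x => ?_
  refine le_add_of_nonneg_left (Finset.sum_nonneg fun i _ => ?_)
  exact mul_nonneg (sq_nonneg _) (inv_nonneg.2 (sq_nonneg _))

theorem abs_lameForm_le_add {M : ℝ} (hM : 0 ≤ M) {lam mu : R3 → ℝ}
    (h : LipschitzModuli M lam mu) (u v : H10) :
    |lameForm lam mu u v| ≤ 3 * M * (‖u‖ ^ 2 + ‖v‖ ^ 2) := by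
  rw [lameForm_eq]
  have i1 := integrable_entrySq (memLp_gradEntries u)
  have i2 := integrable_entrySq (memLp_gradEntries v)
  calc |∫ x, lameDensity (lam x) (mu x) (gradEntries u x) (gradEntries v x) ∂halfMeasure|
      ≤ ∫ x, 3 * M * (entrySq (gradEntries u x) + entrySq (gradEntries v x)) ∂halfMeasure := by
        rw [← Real.norm_eq_abs]
        refine norm_integral_le_of_norm_le ((i1.add i2).const_mul (3 * M)) ?_
        filter_upwards [h.ae_bound hM] with x hx
        exact abs_lameDensity_le hx.1 hx.2 _ _
    _ = 3 * M * (∫ x, entrySq (gradEntries u x) ∂halfMeasure +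
          ∫ x, entrySq (gradEntries v x) ∂halfMeasure) := by
        rw [integral_const_mul, integral_add i1 i2]
    _ ≤ 3 * M * (‖u‖ ^ 2 + ‖v‖ ^ 2) := by
        gcongr <;> exact integral_entrySq_le _

/-- Homogeneity turns the additive bound into a product: on unit vectors it reads `3M (1 + 1) = 6M`.
-/
theorem abs_lameForm_le {M : ℝ} (hM : 0 ≤ M) {lam mu : R3 → ℝ} (h : LipschitzModuli M lam mu)
    (u v : H10) : |lameForm lam mu u v| ≤ 6 * M * ‖u‖ * ‖v‖ := by
  rcases eq_or_ne u 0 with rfl | hu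
  · have := lameForm_smul_left lam mu 0 0 v
    rw [zero_smul, zero_mul] at this
    simp [this]
  rcases eq_or_ne v 0 with rfl | hv
  · have := lameForm_smul_left lam mu 0 0 u
    rw [zero_smul, zero_mul, lameForm_comm] at this
    simp [this]
  have hu' : 0 < ‖u‖ := norm_pos_iff.2 hu
  have hv' : 0 < ‖v‖ := norm_pos_iff.2 hv
  have key := abs_lameForm_le_add hM h (‖u‖⁻¹ • u) (‖v‖⁻¹ • v)
  rw [lameForm_smul_left, lameForm_comm, lameForm_smul_left, lameForm_comm, norm_smul, norm_smul,
    norm_inv, norm_inv, norm_norm, norm_norm, inv_mul_cancel₀ hu'.ne', inv_mul_cancel₀ hv'.ne',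
    abs_mul, abs_mul, abs_of_pos (inv_pos.2 hu'), abs_of_pos (inv_pos.2 hv'),
    inv_mul_le_iff₀ hu', inv_mul_le_iff₀ hv'] at key
  linarith

/-- The Lamé form as a bounded bilinear form. -/
def lameBilin {M : ℝ} (hM : 0 ≤ M) {lam mu : R3 → ℝ} (h : LipschitzModuli M lam mu) :
    H10 →L[ℝ] H10 →L[ℝ] ℝ :=
  LinearMap.mkContinuous₂
    (LinearMap.mk₂ ℝ (lameForm lam mu) (lameForm_add_left hM h) (lameForm_smul_left lam mu)
      (fun u v v' => by
        simp only [lameForm_comm lam mu u]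
        exact lameForm_add_left hM h v v' u)
      (fun c u v => by
        simp only [lameForm_comm lam mu u]
        exact lameForm_smul_left lam mu c v u))
    (6 * M) (abs_lameForm_le hM h)

@[simp] theorem lameBilin_apply {M : ℝ} (hM : 0 ≤ M) {lam mu : R3 → ℝ}
    (h : LipschitzModuli M lam mu) (u v : H10) : lameBilin hM h u v = lameForm lam mu u v := rfl

theorem le_lameForm_self {M α₀ β₀ : ℝ} (hM : 0 ≤ M) {lam mu : R3 → ℝ}
    (h : LipschitzModuli M lam mu) (hc : StronglyConvex α₀ β₀ lam mu) (u : H10) :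
    min (2 * α₀) β₀ * ∫ x, symSq (gradEntries u x) ∂halfMeasure ≤ lameForm lam mu u u := by
  rw [lameForm_eq, ← integral_const_mul]
  refine integral_mono_ae ((integrable_symSq (memLp_gradEntries u)).const_mul _)
    (integrable_lameDensity hM h u u) ?_
  filter_upwards [ae_restrict_mem measurableSet_lowerHalfSpace] with x hx
  exact le_lameDensity_self (hc.shear x hx) (hc.bulk x hx) _

end Elastic

end

/-! ### Lax–Milgram -/

theorem mainTheorem5 (M α₀ β₀ : ℝ) (hM : 0 < M) (hα₀ : 0 < α₀) (hβ₀ : 0 < β₀) :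
    ∃ C : ℝ, 0 < C ∧
      ∀ lam mu : Elastic.R3 → ℝ,
        Elastic.LipschitzModuli M lam mu → Elastic.StronglyConvex α₀ β₀ lam mu →
        ∀ f : StrongDual ℝ Elastic.H10,
          (∃! u : Elastic.H10, Elastic.IsWeakSolution lam mu f u) ∧
          ∀ u : Elastic.H10, Elastic.IsWeakSolution lam mu f u → ‖u‖ ≤ C * ‖f‖ := by
  obtain ⟨K, hK, hkorn⟩ := Elastic.korn_H10
  have hm : 0 < min (2 * α₀) β₀ := lt_min (by linarith) hβ₀
  refine ⟨K / min (2 * α₀) β₀, by positivity, fun lam mu h hc f => ?_⟩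
  have hcoer : ∀ u, ‖u‖ ^ 2 ≤ K / min (2 * α₀) β₀ * Elastic.lameForm lam mu u u := by
    intro u
    have h1 := Elastic.le_lameForm_self hM.le h hc u
    calc ‖u‖ ^ 2 ≤ K * ∫ x, Elastic.symSq (Elastic.gradEntries u x) ∂Elastic.halfMeasure := hkorn u
      _ = K / min (2 * α₀) β₀ * (min (2 * α₀) β₀ *
            ∫ x, Elastic.symSq (Elastic.gradEntries u x) ∂Elastic.halfMeasure) := by
          field_simp
      _ ≤ _ := by gcongr
  have hbound : ∀ (g : StrongDual ℝ Elastic.H10) (u : Elastic.H10),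
      Elastic.IsWeakSolution lam mu g u → ‖u‖ ≤ K / min (2 * α₀) β₀ * ‖g‖ := by
    intro g u hu
    -- Testing with `v = u` gives a bound on `‖u‖²`, which is then divided by `‖u‖`.
    rcases (norm_nonneg u).eq_or_lt with h0 | h0
    · rw [← h0]; positivity
    have h1 := hcoer u
    rw [hu u] at h1
    have h2 : -g u ≤ ‖g‖ * ‖u‖ := (neg_le_abs _).trans (g.le_opNorm u)
    have h3 : ‖u‖ * ‖u‖ ≤ K / min (2 * α₀) β₀ * ‖g‖ * ‖u‖ := by
      rw [← pow_two, mul_assoc]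
      exact h1.trans (by gcongr)
    exact le_of_mul_le_mul_right h3 h0
  have hB : IsCoercive (Elastic.lameBilin hM.le h) := by
    refine ⟨(K / min (2 * α₀) β₀)⁻¹, by positivity, fun u => ?_⟩
    rw [Elastic.lameBilin_apply, mul_assoc, ← pow_two, inv_mul_le_iff₀ (by positivity)]
    exact hcoer u
  set e := hB.continuousLinearEquivOfBilin
  have hform : ∀ u v : Elastic.H10, inner ℝ (e u) v = Elastic.lameForm lam mu u v := fun u v =>
    hB.continuousLinearEquivOfBilin_apply u v
  -- The Riesz representative of `-f`: weak solutions are exactly the solutions of `e u = z`.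
  set z : Elastic.H10 := (InnerProductSpace.toDual ℝ Elastic.H10).symm (-f)
  have hzf : ∀ v : Elastic.H10, inner ℝ z v = -f v := fun v =>
    InnerProductSpace.toDual_symm_apply
  refine ⟨⟨e.symm z, fun v => ?_, fun u' hu' => ?_⟩, hbound f⟩
  · rw [← hform, ContinuousLinearEquiv.apply_symm_apply, hzf]
  · rw [ContinuousLinearEquiv.eq_symm_apply]
    refine ext_inner_right ℝ fun v => ?_
    rw [hform, hzf, hu' v]
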